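/- Let $\theta\in\mathbb R$. All algebras are over $\mathbb C$. For an element of a left (right) comodule write $\rho(a)=a_{(-1)}\otimes a_{(0)}$ (resp. $\delta(a)=a_{(0)}\otimes a_{(1)}$). **Data.** Let $\mathcal O(S^7)$ be the commutative algebra generated by $z_i,z_i^*$ ($i=1,\dots,4$) modulo $\sum_i z_i^*z_i=1$. Let $\mathcal O(SU(2))$ be the commutative Hopf algebra generated by $w_i,w_i^*$ ($i=1,2$) modulo $\sum_i w_i^*w_i=1$ with, for $T=\begin{pmatrix} w_1&-w_2^*\\ w_2&w_1^*\end{pmatrix}$, $\Delta(T^i{}_j)=\sum_k T^i{}_k\otimes T^k{}_j$, $\varepsilon(T)=1$, $S(T)=T^{-1}$. It coacts on the right of $\mathcal O(S^7)$ by the algebra morphism $\delta$ with $\delta(u_{ij})=\sum_k u_{ik}\otimes T^k{}_j$, where $u=\begin{pmatrix} z_1&z_2&z_3&z_4\\ -z_2^*&z_1^*&-z_4^*&z_3^*\end{pmatrix}^{t}$. Let $\mathcal O(S^4)$ be the commutative algebra generated by $\alpha,\alpha^*,\beta,\beta^*,x$ modulo $\alpha^*\alpha+\beta^*\beta+x^2=1$,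 and let $\iota:\mathcal O(S^4)\to\mathcal O(S^7)$ be the algebra morphism $$\alpha\mapsto 2(z_1z_3^*+z_2^*z_4),\quad \beta\mapsto 2(z_2z_3^*-z_1^*z_4),\quad x\mapsto z_1z_1^*+z_2z_2^*-z_3z_3^*-z_4z_4^*,$$ $$\alpha^*\mapsto 2(z_1^*z_3+z_2z_4^*),\qquad \beta^*\mapsto 2(z_2^*z_3-z_1z_4^*).$$ **Deformation.** Let $\mathcal O(\mathbb T^2)=\mathbb C[t_1^{\pm1},t_2^{\pm1}]$ with $t_j^*=t_j^{-1}$ and $t_j$ group-like. It coacts on the left of $\mathcal O(S^7)$ and $\mathcal O(S^4)$ by the algebra morphisms $\rho$ with $z_i\mapsto\tau_i\otimes z_i$, $z_i^*\mapsto\tau_i^{-1}\otimes z_i^*$, $\tau=(t_1,t_1^*,t_2,t_2^*)$, and $\alpha\mapsto t_1t_2^*\otimes\alpha$, $\beta\mapsto t_1^*t_2^*\otimes\beta$, $x\mapsto 1\otimes x$, the inverse monomials being used for $\alpha^*,\beta^*$. Let $\sigma$ be the 2-cocycle on $\mathcal O(\mathbb T^2)$ given by $\sigma(t_j\otimes t_k)=\exp(i\pi\Theta_{jk})$,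 $\Theta=\frac12\begin{pmatrix}0&\theta\\-\theta&0\end{pmatrix}$, and extended by $\sigma(ab\otimes c)=\sigma(a\otimes c_{(1)})\sigma(b\otimes c_{(2)})$, $\sigma(a\otimes bc)=\sigma(a_{(1)}\otimes c)\sigma(a_{(2)}\otimes b)$. The algebras $\mathcal O(S^7_\theta)$ and $\mathcal O(S^4_\theta)$ are the vector spaces $\mathcal O(S^7)$ and $\mathcal O(S^4)$ with unchanged unit and the product $a\bullet b=\sigma(a_{(-1)}\otimes b_{(-1)})\,a_{(0)}b_{(0)}$. With the unchanged linear map $\delta$, $\mathcal O(S^7_\theta)$ is a right $\mathcal O(SU(2))$-comodule algebra. **Definition.** Let $H$ be a Hopf algebra, $A$ a right $H$-comodule algebra and $B=A^{coH}=\{b\in A:\delta(b)=b\otimes1\}$. Then $A$ is a principal $H$-comodule algebra if the antipode of $H$ is bijective, the canonical map $A\otimes_BA\to A\otimes H$, $a\otimes_Ba'\mapsto aa'_{(0)}\otimes a'_{(1)}$, is bijective, and there is a left $B$-linear, right $H$-colinear map $s:A\to B\otimes A$ with $m\circ s=\mathrm{id}_A$, where $m:B\otimes A\to A$ is the product. **Proposition.**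 $\mathcal O(S^7_\theta)$ is a principal $\mathcal O(SU(2))$-comodule algebra over $\mathcal O(S^4_\theta)$. That is, $\mathcal O(S^7_\theta)$ is a principal $\mathcal O(SU(2))$-comodule algebra, and the linear map $\iota$ is an injective algebra morphism $\mathcal O(S^4_\theta)\to\mathcal O(S^7_\theta)$ whose image is the subalgebra $\mathcal O(S^7_\theta)^{co\,\mathcal O(SU(2))}$ of coinvariants. -/

import Mathlib

open scoped TensorProduct

noncomputable section

namespace HopfGalois

universe u v w x

/-! ### Comodule algebras -/

section ComoduleAlgebras

variable (k : Type u) [Field k]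

/-- A structure of right `H`-comodule algebra on the algebra `A`: a right coaction
`δ : A → A ⊗ H` of the Hopf algebra `H` which is a morphism of unital algebras. -/
structure RightComoduleAlgebra (H : Type v) (A : Type w) [Ring H] [HopfAlgebra k H]
    [Ring A] [Algebra k A] where
  /-- the coaction `δ : A → A ⊗ H`, `a ↦ a₍₀₎ ⊗ a₍₁₎` -/
  coact : A →ₐ[k] A ⊗[k] H
  /-- `(id ⊗ Δ) ∘ δ = (δ ⊗ id) ∘ δ` -/
  coassoc : ∀ a : A, (Coalgebra.comul (R := k) (A := H)).lTensor A (coact a) =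
    TensorProduct.assoc k A H H (coact.toLinearMap.rTensor H (coact a))
  /-- `(id ⊗ ε) ∘ δ = id` -/
  counit : ∀ a : A, TensorProduct.rid k A
    ((Coalgebra.counit (R := k) (A := H)).lTensor A (coact a)) = a

/-- A structure of left `K`-comodule algebra on the algebra `A`: a left coaction
`ρ : A → K ⊗ A` of the Hopf algebra `K` which is a morphism of unital algebras. -/
structure LeftComoduleAlgebra (K : Type v) (A : Type w) [Ring K] [HopfAlgebra k K]
    [Ring A] [Algebra k A] where
  /-- the coaction `ρ : A → K ⊗ A`, `a ↦ a₍₋₁₎ ⊗ a₍₀₎` -/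
  coact : A →ₐ[k] K ⊗[k] A
  /-- `(Δ ⊗ id) ∘ ρ = (id ⊗ ρ) ∘ ρ` -/
  coassoc : ∀ a : A, TensorProduct.assoc k K K A
    ((Coalgebra.comul (R := k) (A := K)).rTensor A (coact a)) =
      coact.toLinearMap.lTensor K (coact a)
  /-- `(ε ⊗ id) ∘ ρ = id` -/
  counit : ∀ a : A, TensorProduct.lid k A
    ((Coalgebra.counit (R := k) (A := K)).rTensor A (coact a)) = a

end ComoduleAlgebras

/-! ### Hopf-Galois extensions and principal comodule algebras -/

section Principal

variable {k : Type u} [Field k]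

/-- The span of the elements `a b ⊗ a' - a ⊗ b a'` of `A ⊗ A`, for `b` in the subalgebra `B`. -/
abbrev balancedRelations {A : Type w} [Ring A] [Algebra k A] (B : Subalgebra k A) :
    Submodule k (A ⊗[k] A) :=
  Submodule.span k {t | ∃ a : A, ∃ b ∈ B, ∃ a' : A,
    t = (a * b) ⊗ₜ[k] a' - a ⊗ₜ[k] (b * a')}

/-- The tensor product `A ⊗_B A` over a (not necessarily commutative) subalgebra `B` of `A`:
the quotient of `A ⊗ A` by the span of the elements `a b ⊗ a' - a ⊗ b a'`. -/
abbrev BalancedTensor {A : Type w} [Ring A] [Algebra k A] (B : Subalgebra k A) : Type _ :=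
  (A ⊗[k] A) ⧸ balancedRelations B

namespace RightComoduleAlgebra

variable {H : Type v} {A : Type w} [Ring H] [HopfAlgebra k H] [Ring A] [Algebra k A]
  (δ : RightComoduleAlgebra k H A)

/-- The subalgebra `A^{co H} = {b | δ b = b ⊗ 1}` of coinvariants. -/
def coinvariants : Subalgebra k A :=
  AlgHom.equalizer δ.coact Algebra.TensorProduct.includeLeft

theorem mem_coinvariants {b : A} : b ∈ δ.coinvariants ↔ δ.coact b = b ⊗ₜ[k] (1 : H) :=
  Iff.rfl

/-- The map `A ⊗ A → A ⊗ H`, `a ⊗ a' ↦ a a'₍₀₎ ⊗ a'₍₁₎`. -/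
def preCanonicalMap : A ⊗[k] A →ₗ[k] A ⊗[k] H :=
  LinearMap.mul' k (A ⊗[k] H) ∘ₗ
    TensorProduct.map (Algebra.TensorProduct.includeLeft : A →ₐ[k] A ⊗[k] H).toLinearMap
      δ.coact.toLinearMap

theorem preCanonicalMap_tmul (a a' : A) :
    δ.preCanonicalMap (a ⊗ₜ a') = (a ⊗ₜ[k] (1 : H)) * δ.coact a' := by
  simp [preCanonicalMap]

/-- The canonical map `χ : A ⊗_B A → A ⊗ H`, `a ⊗_B a' ↦ a a'₍₀₎ ⊗ a'₍₁₎`, for `B = A^{co H}`. -/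
def canonicalMap : BalancedTensor δ.coinvariants →ₗ[k] A ⊗[k] H :=
  (balancedRelations δ.coinvariants).liftQ δ.preCanonicalMap <| by
    refine Submodule.span_le.2 ?_
    rintro _ ⟨a, b, hb, a', rfl⟩
    have hb' := δ.mem_coinvariants.1 hb
    simp only [SetLike.mem_coe, LinearMap.mem_ker, map_sub, preCanonicalMap_tmul, map_mul, hb']
    rw [← mul_assoc, Algebra.TensorProduct.tmul_mul_tmul, one_mul, sub_self]

/-- `A^{co H} ⊆ A` is an `H`-Hopf-Galois extension: the canonical map is bijective. -/
def IsHopfGalois : Prop := Function.Bijective δ.canonicalMap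

/-- `A` is equivariantly projective as a left module over `B = A^{co H}`: the restricted product
`m : B ⊗ A → A` has a section `s : A → B ⊗ A` which is left `B`-linear and right `H`-colinear.
Here `B` acts on the first factor of `B ⊗ A` and `H` coacts on the second one. -/
def IsEquivariantlyProjective : Prop :=
  ∃ s : A →ₗ[k] δ.coinvariants ⊗[k] A,
    (∀ (b : δ.coinvariants) (a : A), s (b * a) = (b ⊗ₜ[k] (1 : A)) * s a) ∧
    (∀ a : A, TensorProduct.assoc k δ.coinvariants A H (s.rTensor H (δ.coact a)) =
      δ.coact.toLinearMap.lTensor δ.coinvariants (s a)) ∧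
    (∀ a : A, LinearMap.mul' k A
      (δ.coinvariants.val.toLinearMap.rTensor A (s a)) = a)

/-- `A` is a principal `H`-comodule algebra: `H` has invertible antipode, `A^{co H} ⊆ A` is an
`H`-Hopf-Galois extension and `A` is equivariantly projective as a left `A^{co H}`-module. -/
structure IsPrincipal : Prop where
  antipode_bijective : Function.Bijective (HopfAlgebra.antipode k (A := H))
  isHopfGalois : δ.IsHopfGalois
  isEquivariantlyProjective : δ.IsEquivariantlyProjective

end RightComoduleAlgebra

end Principal

/-! ### Two-cocycles and twisted comodule algebras -/

section Twist

variable {k : Type u} [Field k]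

/-- For `σ : K ⊗ K → k`, the map `K ⊗ K → K`, `g ⊗ h ↦ σ(g₍₁₎ ⊗ h₍₁₎) g₍₂₎ h₍₂₎`. -/
def halfTwist {K : Type v} [Ring K] [HopfAlgebra k K] (σ : K ⊗[k] K →ₗ[k] k) :
    K ⊗[k] K →ₗ[k] K :=
  TensorProduct.lid k K ∘ₗ TensorProduct.map σ (LinearMap.mul' k K) ∘ₗ
    Coalgebra.comul (R := k) (A := K ⊗[k] K)

variable (k) in
/-- A two-cocycle on the Hopf algebra `K`. -/
structure TwoCocycle (K : Type v) [Ring K] [HopfAlgebra k K] where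
  /-- the underlying linear map `σ : K ⊗ K → k` -/
  toLin : K ⊗[k] K →ₗ[k] k
  /-- `σ(g₍₁₎ ⊗ h₍₁₎) σ(g₍₂₎ h₍₂₎ ⊗ l) = σ(h₍₁₎ ⊗ l₍₁₎) σ(g ⊗ h₍₂₎ l₍₂₎)` -/
  cocycle : ∀ g h l : K,
    toLin (halfTwist toLin (g ⊗ₜ h) ⊗ₜ l) = toLin (g ⊗ₜ halfTwist toLin (h ⊗ₜ l))
  /-- `σ` is invertible for the convolution product of linear maps `K ⊗ K → k` -/
  isUnit : IsUnit (WithConv.toConv toLin)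
  /-- `σ(h ⊗ 1) = ε(h)` -/
  map_tmul_one : ∀ h : K, toLin (h ⊗ₜ 1) = Coalgebra.counit (R := k) h
  /-- `σ(1 ⊗ h) = ε(h)` -/
  map_one_tmul : ∀ h : K, toLin (1 ⊗ₜ h) = Coalgebra.counit (R := k) h

variable {K : Type v} {A : Type w} [Ring K] [HopfAlgebra k K] [Ring A] [Algebra k A]

/-- The linear map `(K ⊗ A) ⊗ (K ⊗ A) → A`, `(g ⊗ a) ⊗ (h ⊗ b) ↦ σ(g ⊗ h) a b`. -/
def scaledMul (A : Type w) [Ring A] [Algebra k A] (σ : K ⊗[k] K →ₗ[k] k) :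
    (K ⊗[k] A) ⊗[k] (K ⊗[k] A) →ₗ[k] A :=
  TensorProduct.lid k A ∘ₗ TensorProduct.map σ (LinearMap.mul' k A) ∘ₗ
    (TensorProduct.tensorTensorTensorComm k K A K A).toLinearMap

theorem scaledMul_tmul (σ : K ⊗[k] K →ₗ[k] k) (g h : K) (a b : A) :
    scaledMul A σ ((g ⊗ₜ a) ⊗ₜ (h ⊗ₜ b)) = σ (g ⊗ₜ h) • (a * b) := by
  simp [scaledMul]

/-- The twisted product `a • b = σ(a₍₋₁₎ ⊗ b₍₋₁₎) a₍₀₎ b₍₀₎` on a left `K`-comodule algebra. -/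
def twistedMul (ρ : LeftComoduleAlgebra k K A) (σ : TwoCocycle k K) : A →ₗ[k] A →ₗ[k] A :=
  TensorProduct.curry
    (scaledMul A σ.toLin ∘ₗ TensorProduct.map ρ.coact.toLinearMap ρ.coact.toLinearMap)

theorem twistedMul_apply (ρ : LeftComoduleAlgebra k K A) (σ : TwoCocycle k K) (a b : A) :
    twistedMul ρ σ a b = scaledMul A σ.toLin (ρ.coact a ⊗ₜ ρ.coact b) := by
  simp [twistedMul]

/-- The coaction of a twisted product:
`ρ(a • b) = σ(a₍₋₂₎ ⊗ b₍₋₂₎) a₍₋₁₎ b₍₋₁₎ ⊗ a₍₀₎ b₍₀₎`. -/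
theorem coact_twistedMul (ρ : LeftComoduleAlgebra k K A) (σ : TwoCocycle k K) (a b : A) :
    ρ.coact (twistedMul ρ σ a b) =
      TensorProduct.map (halfTwist σ.toLin) (LinearMap.mul' k A)
        (TensorProduct.tensorTensorTensorComm k K A K A (ρ.coact a ⊗ₜ ρ.coact b)) := by
  have h1 : ∀ p q : K ⊗[k] A, ρ.coact (scaledMul A σ.toLin (p ⊗ₜ q)) =
      scaledMul (K ⊗[k] A) σ.toLin
        (ρ.coact.toLinearMap.lTensor K p ⊗ₜ ρ.coact.toLinearMap.lTensor K q) := by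
    intro p q
    induction p with
    | zero => simp
    | add p p' hp hp' => simp only [TensorProduct.add_tmul, map_add, hp, hp']
    | tmul g x =>
      induction q with
      | zero => simp
      | add q q' hq hq' => simp only [TensorProduct.tmul_add, map_add, hq, hq']
      | tmul h y => simp [scaledMul_tmul]
  have h2 : ∀ p q : K ⊗[k] A, scaledMul (K ⊗[k] A) σ.toLin
      (TensorProduct.assoc k K K A ((Coalgebra.comul (R := k) (A := K)).rTensor A p) ⊗ₜ
        TensorProduct.assoc k K K A ((Coalgebra.comul (R := k) (A := K)).rTensor A q)) =
      TensorProduct.map (halfTwist σ.toLin) (LinearMap.mul' k A)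
        (TensorProduct.tensorTensorTensorComm k K A K A (p ⊗ₜ q)) := by
    intro p q
    induction p with
    | zero => simp
    | add p p' hp hp' => simp only [TensorProduct.add_tmul, map_add, hp, hp']
    | tmul g x =>
      induction q with
      | zero => simp
      | add q q' hq hq' => simp only [TensorProduct.tmul_add, map_add, hq, hq']
      | tmul h y =>
        have h3 : ∀ s t : K ⊗[k] K, scaledMul (K ⊗[k] A) σ.toLin
            (TensorProduct.assoc k K K A (s ⊗ₜ x) ⊗ₜ TensorProduct.assoc k K K A (t ⊗ₜ y)) =
            TensorProduct.lid k K (TensorProduct.map σ.toLin (LinearMap.mul' k K)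
              (TensorProduct.tensorTensorTensorComm k K K K K (s ⊗ₜ t))) ⊗ₜ (x * y) := by
          intro s t
          induction s with
          | zero => simp
          | add s s' hs hs' => simp only [TensorProduct.add_tmul, map_add, hs, hs']
          | tmul s s' =>
            induction t with
            | zero => simp
            | add t t' ht ht' =>
              simp only [TensorProduct.tmul_add, TensorProduct.add_tmul, map_add, ht, ht']
            | tmul t t' => simp [scaledMul_tmul, TensorProduct.smul_tmul']
        simp [halfTwist, h3, TensorProduct.comul_def,
          TensorProduct.AlgebraTensorModule.tensorTensorTensorComm_eq]
  rw [twistedMul_apply, h1, ← ρ.coassoc, ← ρ.coassoc, h2]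

theorem twistedMul_assoc (ρ : LeftComoduleAlgebra k K A) (σ : TwoCocycle k K) (a b c : A) :
    twistedMul ρ σ (twistedMul ρ σ a b) c = twistedMul ρ σ a (twistedMul ρ σ b c) := by
  rw [twistedMul_apply ρ σ _ c, twistedMul_apply ρ σ a (twistedMul ρ σ b c), coact_twistedMul,
    coact_twistedMul]
  generalize ρ.coact a = p
  generalize ρ.coact b = q
  generalize ρ.coact c = r
  induction p with
  | zero => simp
  | add p p' hp hp' => simp only [TensorProduct.add_tmul, map_add, hp, hp']
  | tmul g x =>
    induction q with
    | zero => simp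
    | add q q' hq hq' =>
      simp only [TensorProduct.tmul_add, TensorProduct.add_tmul, map_add, hq, hq']
    | tmul h y =>
      induction r with
      | zero => simp
      | add r r' hr hr' => simp only [TensorProduct.tmul_add, map_add, hr, hr']
      | tmul l z => simp [scaledMul_tmul, σ.cocycle, mul_assoc]

theorem one_twistedMul (ρ : LeftComoduleAlgebra k K A) (σ : TwoCocycle k K) (a : A) :
    twistedMul ρ σ 1 a = a := by
  have h : ∀ p : K ⊗[k] A, scaledMul A σ.toLin ((1 ⊗ₜ 1) ⊗ₜ p) =
      TensorProduct.lid k A ((Coalgebra.counit (R := k) (A := K)).rTensor A p) := by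
    intro p
    induction p with
    | zero => simp
    | add p p' hp hp' => simp only [TensorProduct.tmul_add, map_add, hp, hp']
    | tmul g x => simp [scaledMul_tmul, σ.map_one_tmul]
  rw [twistedMul_apply, map_one, Algebra.TensorProduct.one_def, h, ρ.counit]

theorem twistedMul_one (ρ : LeftComoduleAlgebra k K A) (σ : TwoCocycle k K) (a : A) :
    twistedMul ρ σ a 1 = a := by
  have h : ∀ p : K ⊗[k] A, scaledMul A σ.toLin (p ⊗ₜ (1 ⊗ₜ 1)) =
      TensorProduct.lid k A ((Coalgebra.counit (R := k) (A := K)).rTensor A p) := by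
    intro p
    induction p with
    | zero => simp
    | add p p' hp hp' => simp only [TensorProduct.add_tmul, map_add, hp, hp']
    | tmul g x => simp [scaledMul_tmul, σ.map_tmul_one]
  rw [twistedMul_apply, map_one, Algebra.TensorProduct.one_def, h, ρ.counit]

/-- The twist `_σA` of the left `K`-comodule algebra `(A, ρ)` by the two-cocycle `σ`: the vector
space `A` with the product `twistedMul ρ σ` and the unit of `A`. -/
def Twisted (_ρ : LeftComoduleAlgebra k K A) (_σ : TwoCocycle k K) : Type w := A

namespace Twisted

variable (ρ : LeftComoduleAlgebra k K A) (σ : TwoCocycle k K)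

instance : AddCommGroup (Twisted ρ σ) := inferInstanceAs (AddCommGroup A)

instance : Module k (Twisted ρ σ) := inferInstanceAs (Module k A)

/-- The identity map from `A` to its twist `_σA`, as a linear isomorphism. -/
def of : A ≃ₗ[k] Twisted ρ σ := LinearEquiv.refl k A

instance : Ring (Twisted ρ σ) :=
  { (inferInstance : AddCommGroup (Twisted ρ σ)) with
    one := of ρ σ 1
    mul := fun a b => of ρ σ (twistedMul ρ σ ((of ρ σ).symm a) ((of ρ σ).symm b))
    mul_assoc := twistedMul_assoc ρ σ
    one_mul := one_twistedMul ρ σ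
    mul_one := twistedMul_one ρ σ
    zero_mul := fun a => LinearMap.map_zero₂ (twistedMul ρ σ) a
    mul_zero := fun a => (twistedMul ρ σ a).map_zero
    left_distrib := fun a b c => (twistedMul ρ σ a).map_add b c
    right_distrib := fun a b c => LinearMap.map_add₂ (twistedMul ρ σ) a b c }

instance : Algebra k (Twisted ρ σ) :=
  Algebra.ofModule (fun r a b => LinearMap.map_smul₂ (twistedMul ρ σ) r a b)
    (fun r a b => (twistedMul ρ σ a).map_smul r b)

theorem of_one : of ρ σ 1 = 1 := rfl

theorem of_mul_of (a b : A) : of ρ σ a * of ρ σ b = of ρ σ (twistedMul ρ σ a b) := rfl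

end Twisted

end Twist

/-! ### Bicomodule algebras -/

section Bicomodule

variable {k : Type u} [Field k] {K : Type v} {H : Type x} {A : Type w}
  [Ring K] [HopfAlgebra k K] [Ring H] [HopfAlgebra k H] [Ring A] [Algebra k A]

/-- The left coaction `ρ` of `K` and the right coaction `δ` of `H` commute,
`(ρ ⊗ id) ∘ δ = (id ⊗ δ) ∘ ρ`, so that `A` is a `(K, H)`-bicomodule algebra. -/
def CoactionsCommute (ρ : LeftComoduleAlgebra k K A) (δ : RightComoduleAlgebra k H A) : Prop :=
  ∀ a : A, TensorProduct.assoc k K A H (ρ.coact.toLinearMap.rTensor H (δ.coact a)) =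
    δ.coact.toLinearMap.lTensor K (ρ.coact a)

theorem coact_right_twistedMul (ρ : LeftComoduleAlgebra k K A) (δ : RightComoduleAlgebra k H A)
    (h : CoactionsCommute ρ δ) (σ : TwoCocycle k K) (a b : A) :
    (Twisted.of ρ σ).toLinearMap.rTensor H (δ.coact (twistedMul ρ σ a b)) =
      (Twisted.of ρ σ).toLinearMap.rTensor H (δ.coact a) *
        (Twisted.of ρ σ).toLinearMap.rTensor H (δ.coact b) := by
  have h1 : ∀ p q : K ⊗[k] A, δ.coact (scaledMul A σ.toLin (p ⊗ₜ q)) =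
      scaledMul (A ⊗[k] H) σ.toLin
        (δ.coact.toLinearMap.lTensor K p ⊗ₜ δ.coact.toLinearMap.lTensor K q) := by
    intro p q
    induction p with
    | zero => simp
    | add p p' hp hp' => simp only [TensorProduct.add_tmul, map_add, hp, hp']
    | tmul g x =>
      induction q with
      | zero => simp
      | add q q' hq hq' => simp only [TensorProduct.tmul_add, map_add, hq, hq']
      | tmul h y => simp [scaledMul_tmul]
  have h2 : ∀ p q : A ⊗[k] H, (Twisted.of ρ σ).toLinearMap.rTensor H
      (scaledMul (A ⊗[k] H) σ.toLin
        (TensorProduct.assoc k K A H (ρ.coact.toLinearMap.rTensor H p) ⊗ₜ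
          TensorProduct.assoc k K A H (ρ.coact.toLinearMap.rTensor H q))) =
      (Twisted.of ρ σ).toLinearMap.rTensor H p * (Twisted.of ρ σ).toLinearMap.rTensor H q := by
    intro p q
    induction p with
    | zero => simp
    | add p p' hp hp' => simp only [TensorProduct.add_tmul, map_add, hp, hp', add_mul]
    | tmul x g =>
      induction q with
      | zero => simp
      | add q q' hq hq' => simp only [TensorProduct.tmul_add, map_add, hq, hq', mul_add]
      | tmul y h =>
        have h3 : ∀ s t : K ⊗[k] A, scaledMul (A ⊗[k] H) σ.toLin
            (TensorProduct.assoc k K A H (s ⊗ₜ g) ⊗ₜ TensorProduct.assoc k K A H (t ⊗ₜ h)) =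
            scaledMul A σ.toLin (s ⊗ₜ t) ⊗ₜ (g * h) := by
          intro s t
          induction s with
          | zero => simp
          | add s s' hs hs' => simp only [TensorProduct.add_tmul, map_add, hs, hs']
          | tmul s s' =>
            induction t with
            | zero => simp
            | add t t' ht ht' =>
              simp only [TensorProduct.tmul_add, TensorProduct.add_tmul, map_add, ht, ht']
            | tmul t t' => simp [scaledMul_tmul, TensorProduct.smul_tmul']
        simp only [LinearMap.rTensor_tmul, AlgHom.toLinearMap_apply, h3,
          LinearEquiv.coe_coe, Algebra.TensorProduct.tmul_mul_tmul, Twisted.of_mul_of,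
          twistedMul_apply]
  rw [← h2, h a, h b, twistedMul_apply, h1]

/-- The coaction of `H` on the twist of a `(K, H)`-bicomodule algebra: the same linear map as the
coaction on the untwisted algebra. -/
def twistCoact (ρ : LeftComoduleAlgebra k K A) (δ : RightComoduleAlgebra k H A)
    (h : CoactionsCommute ρ δ) (σ : TwoCocycle k K) :
    Twisted ρ σ →ₐ[k] Twisted ρ σ ⊗[k] H :=
  AlgHom.ofLinearMap
    ((Twisted.of ρ σ).toLinearMap.rTensor H ∘ₗ δ.coact.toLinearMap ∘ₗ
      (Twisted.of ρ σ).symm.toLinearMap)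
    (by
      change (Twisted.of ρ σ).toLinearMap.rTensor H (δ.coact 1) = 1
      rw [map_one, Algebra.TensorProduct.one_def, Algebra.TensorProduct.one_def,
        LinearMap.rTensor_tmul]
      exact congrArg (fun t => t ⊗ₜ[k] (1 : H)) (Twisted.of_one ρ σ))
    (fun a b => coact_right_twistedMul ρ δ h σ a b)

theorem twistCoact_of (ρ : LeftComoduleAlgebra k K A) (δ : RightComoduleAlgebra k H A)
    (h : CoactionsCommute ρ δ) (σ : TwoCocycle k K) (a : A) :
    twistCoact ρ δ h σ (Twisted.of ρ σ a) =
      (Twisted.of ρ σ).toLinearMap.rTensor H (δ.coact a) := rfl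

theorem twistCoact_coassoc (ρ : LeftComoduleAlgebra k K A) (δ : RightComoduleAlgebra k H A)
    (h : CoactionsCommute ρ δ) (σ : TwoCocycle k K) (a : A) :
    (Coalgebra.comul (R := k) (A := H)).lTensor (Twisted ρ σ)
        (twistCoact ρ δ h σ (Twisted.of ρ σ a)) =
      TensorProduct.assoc k (Twisted ρ σ) H H ((twistCoact ρ δ h σ).toLinearMap.rTensor H
        (twistCoact ρ δ h σ (Twisted.of ρ σ a))) := by
  have h1 : ∀ p : A ⊗[k] H, (Coalgebra.comul (R := k) (A := H)).lTensor (Twisted ρ σ)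
      ((Twisted.of ρ σ).toLinearMap.rTensor H p) =
      (Twisted.of ρ σ).toLinearMap.rTensor (H ⊗[k] H)
        ((Coalgebra.comul (R := k) (A := H)).lTensor A p) := by
    intro p
    induction p with
    | zero => simp
    | add p p' hp hp' => simp only [map_add, hp, hp']
    | tmul x g => simp
  have h2 : ∀ p : (A ⊗[k] H) ⊗[k] H, (Twisted.of ρ σ).toLinearMap.rTensor (H ⊗[k] H)
      (TensorProduct.assoc k A H H p) = TensorProduct.assoc k (Twisted ρ σ) H H
        (((Twisted.of ρ σ).toLinearMap.rTensor H).rTensor H p) := by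
    intro p
    rw [LinearMap.rTensor_tensor]
    simp
  have h3 : ∀ p : A ⊗[k] H, (twistCoact ρ δ h σ).toLinearMap.rTensor H
      ((Twisted.of ρ σ).toLinearMap.rTensor H p) =
      ((Twisted.of ρ σ).toLinearMap.rTensor H).rTensor H (δ.coact.toLinearMap.rTensor H p) := by
    intro p
    induction p with
    | zero => simp
    | add p p' hp hp' => simp only [map_add, hp, hp']
    | tmul x g =>
      simp only [LinearMap.rTensor_tmul, AlgHom.toLinearMap_apply, LinearEquiv.coe_coe,
        twistCoact_of]
  rw [twistCoact_of, h1, δ.coassoc, h2, h3]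

theorem twistCoact_counit (ρ : LeftComoduleAlgebra k K A) (δ : RightComoduleAlgebra k H A)
    (h : CoactionsCommute ρ δ) (σ : TwoCocycle k K) (a : A) :
    TensorProduct.rid k (Twisted ρ σ)
      ((Coalgebra.counit (R := k) (A := H)).lTensor (Twisted ρ σ)
        (twistCoact ρ δ h σ (Twisted.of ρ σ a))) = Twisted.of ρ σ a := by
  have h1 : ∀ p : A ⊗[k] H, TensorProduct.rid k (Twisted ρ σ)
      ((Coalgebra.counit (R := k) (A := H)).lTensor (Twisted ρ σ)
        ((Twisted.of ρ σ).toLinearMap.rTensor H p)) =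
      Twisted.of ρ σ (TensorProduct.rid k A
        ((Coalgebra.counit (R := k) (A := H)).lTensor A p)) := by
    intro p
    induction p with
    | zero => simp
    | add p p' hp hp' => simp only [map_add, hp, hp']
    | tmul x g => simp
  rw [twistCoact_of, h1, δ.counit]

/-- The twist of a `(K, H)`-bicomodule algebra by a two-cocycle on `K` is again a right
`H`-comodule algebra, with the same coaction of `H`. -/
def RightComoduleAlgebra.twist (ρ : LeftComoduleAlgebra k K A) (δ : RightComoduleAlgebra k H A)
    (h : CoactionsCommute ρ δ) (σ : TwoCocycle k K) :
    RightComoduleAlgebra k H (Twisted ρ σ) where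
  coact := twistCoact ρ δ h σ
  coassoc := fun a => twistCoact_coassoc ρ δ h σ ((Twisted.of ρ σ).symm a)
  counit := fun a => twistCoact_counit ρ δ h σ ((Twisted.of ρ σ).symm a)

end Bicomodule

end HopfGalois


namespace InstantonBundle

open HopfGalois

/-! ### Coordinate algebras of odd spheres -/

/-- The relation `∑ zᵢ* zᵢ - 1`; the variable `Sum.inl i` is `zᵢ` and `Sum.inr i` is `zᵢ*`. -/
def oddSphereRelation (n : ℕ) : MvPolynomial (Fin n ⊕ Fin n) ℂ :=
  ∑ i : Fin n, MvPolynomial.X (Sum.inr i) * MvPolynomial.X (Sum.inl i) - 1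

/-- The coordinate algebra `𝒪(S²ⁿ⁻¹)`: the commutative `ℂ`-algebra generated by `zᵢ`, `zᵢ*`,
`i = 1, …, n`, modulo the relation `∑ zᵢ* zᵢ = 1`. -/
def OOddSphere (n : ℕ) : Type :=
  MvPolynomial (Fin n ⊕ Fin n) ℂ ⧸ Ideal.span {oddSphereRelation n}

namespace OOddSphere

variable {n : ℕ}

instance : CommRing (OOddSphere n) :=
  inferInstanceAs (CommRing (MvPolynomial (Fin n ⊕ Fin n) ℂ ⧸ Ideal.span {oddSphereRelation n}))

instance : Algebra ℂ (OOddSphere n) :=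
  inferInstanceAs (Algebra ℂ (MvPolynomial (Fin n ⊕ Fin n) ℂ ⧸ Ideal.span {oddSphereRelation n}))

/-- The class in `𝒪(S²ⁿ⁻¹)` of a polynomial in the `zᵢ`, `zᵢ*`. -/
def mk : MvPolynomial (Fin n ⊕ Fin n) ℂ →ₐ[ℂ] OOddSphere n :=
  Ideal.Quotient.mkₐ ℂ (Ideal.span {oddSphereRelation n})

theorem mk_relation : mk (oddSphereRelation n) = 0 :=
  Ideal.Quotient.eq_zero_iff_mem.2 (Ideal.mem_span_singleton_self _)

/-- The generator `zᵢ`. -/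
def z (i : Fin n) : OOddSphere n := mk (MvPolynomial.X (Sum.inl i))

/-- The generator `zᵢ*`. -/
def zs (i : Fin n) : OOddSphere n := mk (MvPolynomial.X (Sum.inr i))

theorem sum_zs_mul_z : ∑ i : Fin n, zs i * z i = 1 := by
  have h := mk_relation (n := n)
  rw [oddSphereRelation, map_sub, map_one, sub_eq_zero, map_sum] at h
  simpa [z, zs] using h

/-- The algebra morphism out of `𝒪(S²ⁿ⁻¹)` with given values on the generators. -/
def lift {R : Type*} [CommRing R] [Algebra ℂ R] (f g : Fin n → R)
    (h : ∑ i, g i * f i = 1) : OOddSphere n →ₐ[ℂ] R :=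
  Ideal.Quotient.liftₐ _ (MvPolynomial.aeval (Sum.elim f g)) <| by
    intro p hp
    obtain ⟨q, rfl⟩ := Ideal.mem_span_singleton'.1 hp
    simp [oddSphereRelation, h]

theorem lift_mk {R : Type*} [CommRing R] [Algebra ℂ R] (f g : Fin n → R)
    (h : ∑ i, g i * f i = 1) (p : MvPolynomial (Fin n ⊕ Fin n) ℂ) :
    lift f g h (mk p) = MvPolynomial.aeval (Sum.elim f g) p := rfl

section

variable {R : Type*} [CommRing R] [Algebra ℂ R]

@[simp]
theorem lift_z (f g : Fin n → R) (h : ∑ i, g i * f i = 1) (i : Fin n) :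
    lift f g h (z i) = f i := by
  simp [z, lift_mk]

@[simp]
theorem lift_zs (f g : Fin n → R) (h : ∑ i, g i * f i = 1) (i : Fin n) :
    lift f g h (zs i) = g i := by
  simp [zs, lift_mk]

theorem algHom_ext {S : Type*} [Semiring S] [Algebra ℂ S] {f g : OOddSphere n →ₐ[ℂ] S}
    (h : ∀ i, f (z i) = g (z i)) (h' : ∀ i, f (zs i) = g (zs i)) : f = g := by
  refine Ideal.Quotient.algHom_ext _ (MvPolynomial.algHom_ext ?_)
  rintro (i | i)
  · exact h i
  · exact h' i

end

end OOddSphere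

open OOddSphere

/-! ### The Hopf algebra `𝒪(SU(2))` -/

/-- The algebra `𝒪(SU(2))`, generated by commuting elements `wᵢ`, `wᵢ*`, `i = 1, 2`, with
`∑ wᵢ* wᵢ = 1`. -/
abbrev OSU2 : Type := OOddSphere 2

/-- The fundamental matrix `T = (w₁, -w₂*; w₂, w₁*)` of `𝒪(SU(2))`. -/
def T : Matrix (Fin 2) (Fin 2) OSU2 := !![z 0, -zs 1; z 1, zs 0]

theorem det_T : (T 0 0) * (T 1 1) - (T 0 1) * (T 1 0) = 1 := by
  have h := sum_zs_mul_z (n := 2)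
  rw [Fin.sum_univ_two] at h
  simp only [T, Matrix.of_apply, Matrix.cons_val', Matrix.cons_val_zero, Matrix.cons_val_one,
    Matrix.cons_val_fin_one]
  linear_combination h

/-- The algebra morphism out of `𝒪(SU(2))` sending `T` to a matrix of determinant one. -/
def liftT {R : Type*} [CommRing R] [Algebra ℂ R] (M : Matrix (Fin 2) (Fin 2) R)
    (h : M 0 0 * M 1 1 - M 0 1 * M 1 0 = 1) : OSU2 →ₐ[ℂ] R :=
  lift ![M 0 0, M 1 0] ![M 1 1, -M 0 1] <| by
    rw [Fin.sum_univ_two]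
    simp only [Matrix.cons_val_zero, Matrix.cons_val_one]
    linear_combination h

@[simp]
theorem liftT_T {R : Type*} [CommRing R] [Algebra ℂ R] (M : Matrix (Fin 2) (Fin 2) R)
    (h : M 0 0 * M 1 1 - M 0 1 * M 1 0 = 1) (i j : Fin 2) : liftT M h (T i j) = M i j := by
  fin_cases i <;> fin_cases j <;> simp [liftT, T]

theorem algHom_ext_T {S : Type*} [Ring S] [Algebra ℂ S] {f g : OSU2 →ₐ[ℂ] S}
    (h : ∀ i j, f (T i j) = g (T i j)) : f = g := by
  refine OOddSphere.algHom_ext (fun i => ?_) (fun i => ?_)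
  · fin_cases i
    · simpa [T] using h 0 0
    · simpa [T] using h 1 0
  · fin_cases i
    · simpa [T] using h 1 1
    · simpa [T] using h 0 1

/-- The coproduct `Δ(Tⁱⱼ) = ∑ₖ Tⁱₖ ⊗ Tᵏⱼ`. -/
def comulSU2 : OSU2 →ₐ[ℂ] OSU2 ⊗[ℂ] OSU2 :=
  liftT (Matrix.of fun i j => ∑ k, T i k ⊗ₜ[ℂ] T k j) <| by
    have hL := congrArg (Algebra.TensorProduct.includeLeft : OSU2 →ₐ[ℂ] OSU2 ⊗[ℂ] OSU2) det_T
    have hR := congrArg (Algebra.TensorProduct.includeRight : OSU2 →ₐ[ℂ] OSU2 ⊗[ℂ] OSU2) det_T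
    have hm : ∀ a b : OSU2, a ⊗ₜ[ℂ] b =
        (Algebra.TensorProduct.includeLeft : OSU2 →ₐ[ℂ] OSU2 ⊗[ℂ] OSU2) a *
          (Algebra.TensorProduct.includeRight : OSU2 →ₐ[ℂ] OSU2 ⊗[ℂ] OSU2) b := by
      intro a b
      simp
    simp only [map_sub, map_mul, map_one] at hL hR
    simp only [Matrix.of_apply, Fin.sum_univ_two, hm]
    generalize (Algebra.TensorProduct.includeLeft : OSU2 →ₐ[ℂ] OSU2 ⊗[ℂ] OSU2) = L at *
    generalize (Algebra.TensorProduct.includeRight : OSU2 →ₐ[ℂ] OSU2 ⊗[ℂ] OSU2) = R at *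
    linear_combination (R (T 0 0) * R (T 1 1) - R (T 0 1) * R (T 1 0)) * hL + hR

/-- The counit `ε(Tⁱⱼ) = δⁱⱼ`. -/
def counitSU2 : OSU2 →ₐ[ℂ] ℂ := liftT 1 (by simp)

/-- The antipode `S(T) = T⁻¹`, the inverse of a matrix of determinant one being its adjugate. -/
def antipodeSU2 : OSU2 →ₐ[ℂ] OSU2 :=
  liftT !![T 1 1, -T 0 1; -T 1 0, T 0 0] <| by
    simp only [Matrix.of_apply, Matrix.cons_val', Matrix.cons_val_zero, Matrix.cons_val_one,
      Matrix.cons_val_fin_one]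
    linear_combination det_T

instance : Bialgebra ℂ OSU2 :=
  Bialgebra.ofAlgHom comulSU2 counitSU2
    (algHom_ext_T fun i j => by
      simp [comulSU2, Fin.sum_univ_two, TensorProduct.add_tmul, TensorProduct.tmul_add]
      abel)
    (algHom_ext_T fun i j => by
      fin_cases i <;> simp [comulSU2, counitSU2, Fin.sum_univ_two])
    (algHom_ext_T fun i j => by
      fin_cases j <;> simp [comulSU2, counitSU2, Fin.sum_univ_two])

theorem comulAlgHom_SU2 : Bialgebra.comulAlgHom ℂ OSU2 = comulSU2 := rfl

theorem counitAlgHom_SU2 : Bialgebra.counitAlgHom ℂ OSU2 = counitSU2 := rfl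

instance : HopfAlgebra ℂ OSU2 :=
  HopfAlgebra.ofAlgHom antipodeSU2
    (algHom_ext_T fun i j => by
      have h := det_T
      rw [comulAlgHom_SU2, counitAlgHom_SU2]
      fin_cases i <;> fin_cases j <;>
        simp [comulSU2, counitSU2, antipodeSU2, Fin.sum_univ_two] <;>
        first | ring1 | linear_combination h)
    (algHom_ext_T fun i j => by
      have h := det_T
      rw [comulAlgHom_SU2, counitAlgHom_SU2]
      fin_cases i <;> fin_cases j <;>
        simp [comulSU2, counitSU2, antipodeSU2, Fin.sum_univ_two] <;>
        first | ring1 | linear_combination h)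

theorem comul_SU2 (a : OSU2) : Coalgebra.comul (R := ℂ) a = comulSU2 a := rfl

theorem counit_SU2 (a : OSU2) : Coalgebra.counit (R := ℂ) a = counitSU2 a := rfl

/-! ### The right coaction of `𝒪(SU(2))` on `𝒪(S⁷)` -/

/-- The algebra `𝒪(S⁷)`. -/
abbrev OS7 : Type := OOddSphere 4

/-- The `4 × 2` matrix of generators of `𝒪(S⁷)`, the transpose of
`(z₁, z₂, z₃, z₄; -z₂*, z₁*, -z₄*, z₃*)`. -/
def u : Matrix (Fin 4) (Fin 2) OS7 :=
  !![z 0, -zs 1; z 1, zs 0; z 2, -zs 3; z 3, zs 2]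

/-- The matrix `u ⊗̇ T` with entries `∑ₖ uᵢₖ ⊗ Tᵏⱼ`. -/
def uT : Matrix (Fin 4) (Fin 2) (OS7 ⊗[ℂ] OSU2) :=
  Matrix.of fun i j => ∑ k, u i k ⊗ₜ[ℂ] T k j

theorem det_u :
    u 0 0 * u 1 1 - u 0 1 * u 1 0 + (u 2 0 * u 3 1 - u 2 1 * u 3 0) = 1 := by
  have h := sum_zs_mul_z (n := 4)
  rw [Fin.sum_univ_four] at h
  simp [u]
  linear_combination h

theorem algHom_ext_u {S : Type*} [Ring S] [Algebra ℂ S] {f g : OS7 →ₐ[ℂ] S}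
    (h : ∀ i j, f (u i j) = g (u i j)) : f = g := by
  refine OOddSphere.algHom_ext (fun i => ?_) (fun i => ?_)
  · fin_cases i
    · simpa [u] using h 0 0
    · simpa [u] using h 1 0
    · simpa [u] using h 2 0
    · simpa [u] using h 3 0
  · fin_cases i
    · simpa [u] using h 1 1
    · simpa [u] using h 0 1
    · simpa [u] using h 3 1
    · simpa [u] using h 2 1

/-- The coaction `δ : 𝒪(S⁷) → 𝒪(S⁷) ⊗ 𝒪(SU(2))` as an algebra morphism. -/
def coactSU2 : OS7 →ₐ[ℂ] OS7 ⊗[ℂ] OSU2 :=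
  lift ![uT 0 0, uT 1 0, uT 2 0, uT 3 0] ![uT 1 1, -uT 0 1, uT 3 1, -uT 2 1] <| by
    have hL := congrArg (Algebra.TensorProduct.includeLeft : OS7 →ₐ[ℂ] OS7 ⊗[ℂ] OSU2) det_u
    have hR := congrArg (Algebra.TensorProduct.includeRight : OSU2 →ₐ[ℂ] OS7 ⊗[ℂ] OSU2) det_T
    have hm : ∀ (a : OS7) (b : OSU2), a ⊗ₜ[ℂ] b =
        (Algebra.TensorProduct.includeLeft : OS7 →ₐ[ℂ] OS7 ⊗[ℂ] OSU2) a *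
          (Algebra.TensorProduct.includeRight : OSU2 →ₐ[ℂ] OS7 ⊗[ℂ] OSU2) b := by
      intro a b
      simp
    simp only [map_sub, map_mul, map_one, map_add] at hL hR
    rw [Fin.sum_univ_four]
    change uT 1 1 * uT 0 0 + -uT 0 1 * uT 1 0 + uT 3 1 * uT 2 0 + -uT 2 1 * uT 3 0 = 1
    simp only [uT, Matrix.of_apply, Fin.sum_univ_two, hm]
    generalize (Algebra.TensorProduct.includeLeft : OS7 →ₐ[ℂ] OS7 ⊗[ℂ] OSU2) = L at *
    generalize (Algebra.TensorProduct.includeRight : OSU2 →ₐ[ℂ] OS7 ⊗[ℂ] OSU2) = R at *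
    linear_combination (R (T 0 0) * R (T 1 1) - R (T 0 1) * R (T 1 0)) * hL + hR

/-- The coaction is `δ(u) = u ⊗̇ T` on the matrix of generators. -/
theorem coactSU2_u (i : Fin 4) (j : Fin 2) :
    coactSU2 (u i j) = ∑ k, u i k ⊗ₜ[ℂ] T k j := by
  change _ = uT i j
  fin_cases i <;> fin_cases j <;> simp [u, coactSU2]

/-- `𝒪(S⁷)` as a right `𝒪(SU(2))`-comodule algebra. -/
def rightS7 : RightComoduleAlgebra ℂ OSU2 OS7 where
  coact := coactSU2
  coassoc := by
    have h : (Algebra.TensorProduct.map (AlgHom.id ℂ OS7) comulSU2).comp coactSU2 =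
        (Algebra.TensorProduct.assoc ℂ ℂ ℂ OS7 OSU2 OSU2).toAlgHom.comp
          ((Algebra.TensorProduct.map coactSU2 (AlgHom.id ℂ OSU2)).comp coactSU2) :=
      algHom_ext_u fun i j => by
        simp [coactSU2_u, comulSU2, Fin.sum_univ_two, TensorProduct.add_tmul,
          TensorProduct.tmul_add]
        abel
    exact fun a => congrArg (fun f => f a) h
  counit := by
    have h : ((Algebra.TensorProduct.rid ℂ ℂ OS7).toAlgHom.comp
        (Algebra.TensorProduct.map (AlgHom.id ℂ OS7) counitSU2)).comp coactSU2 =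
        AlgHom.id ℂ OS7 :=
      algHom_ext_u fun i j => by
        fin_cases j <;> simp [coactSU2_u, counitSU2, Fin.sum_univ_two]
    exact fun a => congrArg (fun f => f a) h

/-! ### The torus, its coaction on `𝒪(S⁷)`, and the two-cocycle -/

/-- The Hopf algebra `𝒪(𝕋²)` of Laurent polynomials in `t₁, t₂`, that is the group algebra of
`ℤ²`, in which every monomial is group-like. -/
abbrev OTorus : Type := AddMonoidAlgebra ℂ (Fin 2 → ℤ)

/-- The monomial `t₁ ^ m₁ t₂ ^ m₂`. -/
def tpow (m : Fin 2 → ℤ) : OTorus := AddMonoidAlgebra.single m 1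

/-- The exponent of the generator `tⱼ`; that of `tⱼ* = tⱼ⁻¹` is its opposite. -/
def e (j : Fin 2) : Fin 2 → ℤ := Pi.single j 1

theorem tpow_add (m n : Fin 2 → ℤ) : tpow (m + n) = tpow m * tpow n := by
  simp [tpow, AddMonoidAlgebra.single_mul_single]

theorem tpow_zero : tpow 0 = 1 := rfl

theorem comul_tpow (m : Fin 2 → ℤ) : Coalgebra.comul (R := ℂ) (tpow m) = tpow m ⊗ₜ tpow m := by
  simp [tpow]

theorem counit_tpow (m : Fin 2 → ℤ) : Coalgebra.counit (R := ℂ) (tpow m) = 1 := by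
  simp [tpow]

/-- The exponents of `τ = (t₁, t₁*, t₂, t₂*)`. -/
def weight : Fin 4 → Fin 2 → ℤ := ![e 0, -e 0, e 1, -e 1]

/-- The coaction `ρ : 𝒪(S⁷) → 𝒪(𝕋²) ⊗ 𝒪(S⁷)`, `zᵢ ↦ τᵢ ⊗ zᵢ`, `zᵢ* ↦ τᵢ* ⊗ zᵢ*`. -/
def coactTorusS7 : OS7 →ₐ[ℂ] OTorus ⊗[ℂ] OS7 :=
  lift (fun i => tpow (weight i) ⊗ₜ[ℂ] z i) (fun i => tpow (-weight i) ⊗ₜ[ℂ] zs i) <| by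
    simp only [Algebra.TensorProduct.tmul_mul_tmul, ← tpow_add, neg_add_cancel, tpow_zero]
    rw [← TensorProduct.tmul_sum, sum_zs_mul_z, Algebra.TensorProduct.one_def]

/-- `𝒪(S⁷)` as a left `𝒪(𝕋²)`-comodule algebra. -/
def leftS7 : LeftComoduleAlgebra ℂ OTorus OS7 where
  coact := coactTorusS7
  coassoc := by
    have h : (Algebra.TensorProduct.assoc ℂ ℂ ℂ OTorus OTorus OS7).toAlgHom.comp
        ((Algebra.TensorProduct.map (Bialgebra.comulAlgHom ℂ OTorus) (AlgHom.id ℂ OS7)).comp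
          coactTorusS7) =
        (Algebra.TensorProduct.map (AlgHom.id ℂ OTorus) coactTorusS7).comp coactTorusS7 :=
      OOddSphere.algHom_ext (fun i => by simp [coactTorusS7, comul_tpow])
        (fun i => by simp [coactTorusS7, comul_tpow])
    exact fun a => congrArg (fun f => f a) h
  counit := by
    have h : ((Algebra.TensorProduct.lid ℂ OS7).toAlgHom.comp
        (Algebra.TensorProduct.map (Bialgebra.counitAlgHom ℂ OTorus) (AlgHom.id ℂ OS7))).comp
          coactTorusS7 = AlgHom.id ℂ OS7 :=
      OOddSphere.algHom_ext (fun i => by simp [coactTorusS7, counit_tpow])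
        (fun i => by simp [coactTorusS7, counit_tpow])
    exact fun a => congrArg (fun f => f a) h

/-- The coactions of `𝒪(𝕋²)` and `𝒪(SU(2))` make `𝒪(S⁷)` a bicomodule algebra. -/
theorem coactionsCommute_S7 : CoactionsCommute leftS7 rightS7 := by
  have h : (Algebra.TensorProduct.assoc ℂ ℂ ℂ OTorus OS7 OSU2).toAlgHom.comp
      ((Algebra.TensorProduct.map coactTorusS7 (AlgHom.id ℂ OSU2)).comp coactSU2) =
      (Algebra.TensorProduct.map (AlgHom.id ℂ OTorus) coactSU2).comp coactTorusS7 :=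
    OOddSphere.algHom_ext
      (fun i => by
        fin_cases i <;> simp [coactTorusS7, coactSU2, uT, u, weight, Fin.sum_univ_two,
          TensorProduct.tmul_add, TensorProduct.tmul_neg, TensorProduct.neg_tmul])
      (fun i => by
        fin_cases i <;> simp [coactTorusS7, coactSU2, uT, u, weight, Fin.sum_univ_two,
          TensorProduct.tmul_add, TensorProduct.tmul_neg, TensorProduct.neg_tmul])
  exact fun a => congrArg (fun f => f a) h

/-- The matrix `Θ = ½ (0, θ; -θ, 0)`. -/
def Theta (θ : ℝ) : Matrix (Fin 2) (Fin 2) ℝ := (1 / 2 : ℝ) • !![0, θ; -θ, 0]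

/-- The bicharacter `(m, n) ↦ exp(iπ ∑ mⱼ Θⱼₖ nₖ)` of `ℤ²`. -/
def bichar (θ : ℝ) (m n : Fin 2 → ℤ) : ℂ :=
  Complex.exp (Complex.I * Real.pi * ((∑ j, ∑ k, m j * Theta θ j k * n k : ℝ) : ℂ))

theorem bichar_add_left (θ : ℝ) (m m' n : Fin 2 → ℤ) :
    bichar θ (m + m') n = bichar θ m n * bichar θ m' n := by
  rw [bichar, bichar, bichar, ← Complex.exp_add]
  congr 1
  simp only [Pi.add_apply, Fin.sum_univ_two]
  push_cast
  ring

theorem bichar_add_right (θ : ℝ) (m n n' : Fin 2 → ℤ) :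
    bichar θ m (n + n') = bichar θ m n * bichar θ m n' := by
  rw [bichar, bichar, bichar, ← Complex.exp_add]
  congr 1
  simp only [Pi.add_apply, Fin.sum_univ_two]
  push_cast
  ring

theorem bichar_neg (θ : ℝ) (m n : Fin 2 → ℤ) : bichar (-θ) m n * bichar θ m n = 1 := by
  rw [bichar, bichar, ← Complex.exp_add, ← Complex.exp_zero]
  congr 1
  simp only [Theta, Fin.sum_univ_two, Matrix.smul_apply, Matrix.of_apply, Matrix.cons_val',
    Matrix.cons_val_zero, Matrix.cons_val_one, Matrix.cons_val_fin_one, smul_eq_mul]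
  push_cast
  ring

/-- The linear map `σ : 𝒪(𝕋²) ⊗ 𝒪(𝕋²) → ℂ` with `σ(tᵐ ⊗ tⁿ) = exp(iπ ∑ mⱼ Θⱼₖ nₖ)`. -/
def sigmaLin (θ : ℝ) : OTorus ⊗[ℂ] OTorus →ₗ[ℂ] ℂ :=
  TensorProduct.lift
    (Finsupp.linearCombination ℂ (fun m : Fin 2 → ℤ =>
      Finsupp.linearCombination ℂ (fun n : Fin 2 → ℤ => bichar θ m n) ∘ₗ
        (AddMonoidAlgebra.coeffLinearEquiv ℂ).toLinearMap) ∘ₗ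
      (AddMonoidAlgebra.coeffLinearEquiv ℂ).toLinearMap)

theorem sigmaLin_tpow (θ : ℝ) (m n : Fin 2 → ℤ) :
    sigmaLin θ (tpow m ⊗ₜ tpow n) = bichar θ m n := by
  simp [sigmaLin, tpow]

theorem tpow_induction {P : OTorus → Prop} (h0 : P 0) (hadd : ∀ a b, P a → P b → P (a + b))
    (hsmul : ∀ (c : ℂ) (m : Fin 2 → ℤ), P (c • tpow m)) (a : OTorus) : P a := by
  induction a using AddMonoidAlgebra.induction_linear with
  | zero => exact h0
  | add f g hf hg => exact hadd f g hf hg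
  | single m c =>
    have := hsmul c m
    simpa [tpow, AddMonoidAlgebra.smul_single] using this

/-- Two linear maps on `𝒪(𝕋²) ⊗ 𝒪(𝕋²)` which agree on monomials are equal. -/
theorem tensor_hom_ext {N : Type*} [AddCommGroup N] [Module ℂ N]
    {f g : OTorus ⊗[ℂ] OTorus →ₗ[ℂ] N}
    (h : ∀ m n, f (tpow m ⊗ₜ tpow n) = g (tpow m ⊗ₜ tpow n)) : f = g := by
  refine TensorProduct.ext' fun a b => ?_
  induction a using tpow_induction with
  | h0 => simp
  | hadd a a' ha ha' => simp only [TensorProduct.add_tmul, map_add, ha, ha']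
  | hsmul c m =>
    induction b using tpow_induction with
    | h0 => simp
    | hadd b b' hb hb' => simp only [TensorProduct.tmul_add, map_add, hb, hb']
    | hsmul d n =>
      simp only [← TensorProduct.smul_tmul', TensorProduct.tmul_smul, map_smul, h]

theorem comul_tpow_tmul (m n : Fin 2 → ℤ) :
    Coalgebra.comul (R := ℂ) (tpow m ⊗ₜ[ℂ] tpow n) =
      (tpow m ⊗ₜ[ℂ] tpow n) ⊗ₜ[ℂ] (tpow m ⊗ₜ[ℂ] tpow n) := by
  simp [TensorProduct.comul_def, comul_tpow]

theorem halfTwist_tpow (θ : ℝ) (m n : Fin 2 → ℤ) :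
    halfTwist (sigmaLin θ) (tpow m ⊗ₜ tpow n) = bichar θ m n • tpow (m + n) := by
  rw [halfTwist, LinearMap.comp_apply, LinearMap.comp_apply, comul_tpow_tmul]
  simp [sigmaLin_tpow, tpow_add]

theorem sigmaLin_conv (θ : ℝ) :
    WithConv.toConv (sigmaLin (-θ)) * WithConv.toConv (sigmaLin θ) = 1 := by
  refine WithConv.ext (tensor_hom_ext fun m n => ?_)
  change LinearMap.mul' ℂ ℂ (TensorProduct.map (sigmaLin (-θ)) (sigmaLin θ)
    (Coalgebra.comul (R := ℂ) (tpow m ⊗ₜ[ℂ] tpow n))) = _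
  rw [comul_tpow_tmul]
  simp [LinearMap.convOne_def, sigmaLin_tpow, bichar_neg, counit_tpow]

theorem sigmaLin_cocycle (θ : ℝ) (g h l : OTorus) :
    sigmaLin θ (halfTwist (sigmaLin θ) (g ⊗ₜ h) ⊗ₜ l) =
      sigmaLin θ (g ⊗ₜ halfTwist (sigmaLin θ) (h ⊗ₜ l)) := by
  induction g using tpow_induction with
  | h0 => simp
  | hadd a a' ha ha' => simp only [TensorProduct.add_tmul, map_add, ha, ha']
  | hsmul c m =>
    induction h using tpow_induction with
    | h0 => simp
    | hadd b b' hb hb' =>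
      simp only [TensorProduct.tmul_add, TensorProduct.add_tmul, map_add, hb, hb']
    | hsmul d n =>
      induction l using tpow_induction with
      | h0 => simp
      | hadd b b' hb hb' => simp only [TensorProduct.tmul_add, map_add, hb, hb']
      | hsmul d r =>
        simp only [← TensorProduct.smul_tmul', TensorProduct.tmul_smul, map_smul, halfTwist_tpow,
          sigmaLin_tpow, bichar_add_left, bichar_add_right, smul_eq_mul]
        ring

theorem bichar_zero_left (θ : ℝ) (n : Fin 2 → ℤ) : bichar θ 0 n = 1 := by simp [bichar]

theorem bichar_zero_right (θ : ℝ) (m : Fin 2 → ℤ) : bichar θ m 0 = 1 := by simp [bichar]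

/-- The two-cocycle `σ` on `𝒪(𝕋²)`; it is determined by `sigma_generators`, `sigma_mul_left` and
`sigma_mul_right` below. -/
def sigma (θ : ℝ) : TwoCocycle ℂ OTorus where
  toLin := sigmaLin θ
  cocycle := sigmaLin_cocycle θ
  isUnit := by
    refine ⟨⟨_, WithConv.toConv (sigmaLin (-θ)), ?_, sigmaLin_conv θ⟩, rfl⟩
    simpa using sigmaLin_conv (-θ)
  map_tmul_one := fun h => by
    induction h using tpow_induction with
    | h0 => simp
    | hadd a a' ha ha' => simp only [TensorProduct.add_tmul, map_add, ha, ha']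
    | hsmul c m =>
      simp only [← TensorProduct.smul_tmul', map_smul, ← tpow_zero, sigmaLin_tpow,
        bichar_zero_right, counit_tpow]
  map_one_tmul := fun h => by
    induction h using tpow_induction with
    | h0 => simp
    | hadd a a' ha ha' => simp only [TensorProduct.tmul_add, map_add, ha, ha']
    | hsmul c m =>
      simp only [TensorProduct.tmul_smul, map_smul, ← tpow_zero, sigmaLin_tpow,
        bichar_zero_left, counit_tpow]

/-- `σ(tⱼ ⊗ tₖ) = exp(iπ Θⱼₖ)`. -/
theorem sigma_generators (θ : ℝ) (j k : Fin 2) :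
    (sigma θ).toLin (tpow (e j) ⊗ₜ tpow (e k)) =
      Complex.exp (Complex.I * Real.pi * (Theta θ j k : ℂ)) := by
  change sigmaLin θ _ = _
  rw [sigmaLin_tpow, bichar]
  fin_cases j <;> fin_cases k <;> simp [e, Fin.sum_univ_two]

/-- `σ(ab ⊗ c) = σ(a ⊗ c₍₁₎) σ(b ⊗ c₍₂₎)`. -/
theorem sigma_mul_left (θ : ℝ) (a b c : OTorus) :
    (sigma θ).toLin ((a * b) ⊗ₜ c) =
      LinearMap.mul' ℂ ℂ (TensorProduct.map
        ((sigma θ).toLin ∘ₗ TensorProduct.mk ℂ OTorus OTorus a)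
        ((sigma θ).toLin ∘ₗ TensorProduct.mk ℂ OTorus OTorus b)
        (Coalgebra.comul (R := ℂ) c)) := by
  change sigmaLin θ _ = LinearMap.mul' ℂ ℂ (TensorProduct.map (sigmaLin θ ∘ₗ _)
    (sigmaLin θ ∘ₗ _) _)
  induction a using tpow_induction with
  | h0 => simp
  | hadd a a' ha ha' =>
    simp only [add_mul, TensorProduct.add_tmul, map_add, LinearMap.comp_add,
      TensorProduct.map_add_left, LinearMap.add_apply, ha, ha']
  | hsmul r m =>
    induction b using tpow_induction with
    | h0 => simp
    | hadd b b' hb hb' =>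
      simp only [mul_add, TensorProduct.add_tmul, map_add, LinearMap.comp_add,
        TensorProduct.map_add_right, LinearMap.add_apply, hb, hb']
    | hsmul s n =>
      induction c using tpow_induction with
      | h0 => simp
      | hadd c c' hc hc' => simp only [TensorProduct.tmul_add, map_add, hc, hc']
      | hsmul t l =>
        simp [comul_tpow, ← tpow_add, sigmaLin_tpow, bichar_add_left,
          ← TensorProduct.smul_tmul']
        refine Or.inl ?_
        ring

/-- `σ(a ⊗ bc) = σ(a₍₁₎ ⊗ c) σ(a₍₂₎ ⊗ b)`. -/
theorem sigma_mul_right (θ : ℝ) (a b c : OTorus) :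
    (sigma θ).toLin (a ⊗ₜ (b * c)) =
      LinearMap.mul' ℂ ℂ (TensorProduct.map
        ((sigma θ).toLin ∘ₗ (TensorProduct.mk ℂ OTorus OTorus).flip c)
        ((sigma θ).toLin ∘ₗ (TensorProduct.mk ℂ OTorus OTorus).flip b)
        (Coalgebra.comul (R := ℂ) a)) := by
  change sigmaLin θ _ = LinearMap.mul' ℂ ℂ (TensorProduct.map (sigmaLin θ ∘ₗ _)
    (sigmaLin θ ∘ₗ _) _)
  induction b using tpow_induction with
  | h0 => simp
  | hadd b b' hb hb' =>
    simp only [add_mul, TensorProduct.tmul_add, map_add, LinearMap.comp_add,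
      TensorProduct.map_add_right, LinearMap.add_apply, hb, hb']
  | hsmul r m =>
    induction c using tpow_induction with
    | h0 => simp
    | hadd c c' hc hc' =>
      simp only [mul_add, TensorProduct.tmul_add, map_add, LinearMap.comp_add,
        TensorProduct.map_add_left, LinearMap.add_apply, hc, hc']
    | hsmul s n =>
      induction a using tpow_induction with
      | h0 => simp
      | hadd a a' ha ha' => simp only [TensorProduct.add_tmul, map_add, ha, ha']
      | hsmul t l =>
        simp [comul_tpow, ← tpow_add, sigmaLin_tpow, bichar_add_right,
          ← TensorProduct.smul_tmul']
        ring

/-! ### The algebra `𝒪(S⁴)` and its embedding in `𝒪(S⁷)` -/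

/-- The names of the generators of `𝒪(S⁴)`. -/
inductive S4Gen : Type
  | alpha | alphaStar | beta | betaStar | x

/-- The relation `α* α + β* β + x² - 1`. -/
def relationS4 : MvPolynomial S4Gen ℂ :=
  MvPolynomial.X S4Gen.alphaStar * MvPolynomial.X S4Gen.alpha +
    MvPolynomial.X S4Gen.betaStar * MvPolynomial.X S4Gen.beta + MvPolynomial.X S4Gen.x ^ 2 - 1

/-- The coordinate algebra `𝒪(S⁴)`: the commutative `ℂ`-algebra generated by `α, α*, β, β*, x`
modulo the relation `α* α + β* β + x² = 1`. -/
def OS4 : Type := MvPolynomial S4Gen ℂ ⧸ Ideal.span {relationS4}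

namespace OS4

instance : CommRing OS4 :=
  inferInstanceAs (CommRing (MvPolynomial S4Gen ℂ ⧸ Ideal.span {relationS4}))

instance : Algebra ℂ OS4 :=
  inferInstanceAs (Algebra ℂ (MvPolynomial S4Gen ℂ ⧸ Ideal.span {relationS4}))

/-- The class in `𝒪(S⁴)` of a polynomial in the generators. -/
def mk : MvPolynomial S4Gen ℂ →ₐ[ℂ] OS4 := Ideal.Quotient.mkₐ ℂ (Ideal.span {relationS4})

theorem mk_relation : mk relationS4 = 0 :=
  Ideal.Quotient.eq_zero_iff_mem.2 (Ideal.mem_span_singleton_self _)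

/-- The generators of `𝒪(S⁴)`. -/
def gen (i : S4Gen) : OS4 := mk (MvPolynomial.X i)

theorem relation : gen .alphaStar * gen .alpha + gen .betaStar * gen .beta + gen .x ^ 2 = 1 := by
  have h := mk_relation
  rw [relationS4, map_sub, map_one, sub_eq_zero] at h
  simpa [gen] using h

/-- The algebra morphism out of `𝒪(S⁴)` with given values on the generators. -/
def lift {R : Type*} [CommRing R] [Algebra ℂ R] (f : S4Gen → R)
    (h : f .alphaStar * f .alpha + f .betaStar * f .beta + f .x ^ 2 = 1) : OS4 →ₐ[ℂ] R :=
  Ideal.Quotient.liftₐ _ (MvPolynomial.aeval f) <| by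
    intro p hp
    obtain ⟨q, rfl⟩ := Ideal.mem_span_singleton'.1 hp
    simp [relationS4, h]

theorem lift_mk {R : Type*} [CommRing R] [Algebra ℂ R] (f : S4Gen → R)
    (h : f .alphaStar * f .alpha + f .betaStar * f .beta + f .x ^ 2 = 1)
    (p : MvPolynomial S4Gen ℂ) : lift f h (mk p) = MvPolynomial.aeval f p := rfl

@[simp]
theorem lift_gen {R : Type*} [CommRing R] [Algebra ℂ R] (f : S4Gen → R)
    (h : f .alphaStar * f .alpha + f .betaStar * f .beta + f .x ^ 2 = 1) (i : S4Gen) :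
    lift f h (gen i) = f i := by
  simp [gen, lift_mk]

theorem algHom_ext {S : Type*} [Semiring S] [Algebra ℂ S] {f g : OS4 →ₐ[ℂ] S}
    (h : ∀ i, f (gen i) = g (gen i)) : f = g :=
  Ideal.Quotient.algHom_ext _ (MvPolynomial.algHom_ext h)

end OS4

/-- The degrees in `ℤ²` of the generators of `𝒪(S⁴)`: those of `t₁ t₂*` for `α`, of `t₁* t₂*` for
`β`, of `1` for `x`, and the opposite ones for `α*` and `β*`. -/
def weightS4 : S4Gen → Fin 2 → ℤ
  | .alpha => e 0 - e 1
  | .alphaStar => -(e 0 - e 1)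
  | .beta => -e 0 - e 1
  | .betaStar => -(-e 0 - e 1)
  | .x => 0

/-- The coaction `𝒪(S⁴) → 𝒪(𝕋²) ⊗ 𝒪(S⁴)`, `α ↦ t₁ t₂* ⊗ α`, `β ↦ t₁* t₂* ⊗ β`, `x ↦ 1 ⊗ x`. -/
def coactTorusS4 : OS4 →ₐ[ℂ] OTorus ⊗[ℂ] OS4 :=
  OS4.lift (fun i => tpow (weightS4 i) ⊗ₜ[ℂ] OS4.gen i) <| by
    simp only [weightS4, pow_two, Algebra.TensorProduct.tmul_mul_tmul, ← tpow_add,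
      neg_add_cancel, tpow_zero, ← TensorProduct.tmul_add, mul_one]
    rw [← pow_two, OS4.relation, Algebra.TensorProduct.one_def]

/-- `𝒪(S⁴)` as a left `𝒪(𝕋²)`-comodule algebra. -/
def leftS4 : LeftComoduleAlgebra ℂ OTorus OS4 where
  coact := coactTorusS4
  coassoc := by
    have h : (Algebra.TensorProduct.assoc ℂ ℂ ℂ OTorus OTorus OS4).toAlgHom.comp
        ((Algebra.TensorProduct.map (Bialgebra.comulAlgHom ℂ OTorus) (AlgHom.id ℂ OS4)).comp
          coactTorusS4) =
        (Algebra.TensorProduct.map (AlgHom.id ℂ OTorus) coactTorusS4).comp coactTorusS4 :=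
      OS4.algHom_ext (fun i => by simp [coactTorusS4, comul_tpow])
    exact fun a => congrArg (fun f => f a) h
  counit := by
    have h : ((Algebra.TensorProduct.lid ℂ OS4).toAlgHom.comp
        (Algebra.TensorProduct.map (Bialgebra.counitAlgHom ℂ OTorus) (AlgHom.id ℂ OS4))).comp
          coactTorusS4 = AlgHom.id ℂ OS4 :=
      OS4.algHom_ext (fun i => by simp [coactTorusS4, counit_tpow])
    exact fun a => congrArg (fun f => f a) h

/-- The elements of `𝒪(S⁷)` to which the generators of `𝒪(S⁴)` are sent:
`α = 2(z₁z₃* + z₂*z₄)`, `β = 2(z₂z₃* - z₁*z₄)`, `x = z₁z₁* + z₂z₂* - z₃z₃* - z₄z₄*`, and the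
conjugates `α*`, `β*`. -/
def baseGen : S4Gen → OS7
  | .alpha => 2 * (z 0 * zs 2 + zs 1 * z 3)
  | .alphaStar => 2 * (zs 0 * z 2 + z 1 * zs 3)
  | .beta => 2 * (z 1 * zs 2 - zs 0 * z 3)
  | .betaStar => 2 * (zs 1 * z 2 - z 0 * zs 3)
  | .x => z 0 * zs 0 + z 1 * zs 1 - z 2 * zs 2 - z 3 * zs 3

/-- The algebra morphism `𝒪(S⁴) → 𝒪(S⁷)` dual to the bundle projection `S⁷ → S⁴`. -/
def baseInclusion : OS4 →ₐ[ℂ] OS7 :=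
  OS4.lift baseGen <| by
    have h := sum_zs_mul_z (n := 4)
    rw [Fin.sum_univ_four] at h
    simp only [baseGen]
    linear_combination
      (zs 0 * z 0 + zs 1 * z 1 + zs 2 * z 2 + zs 3 * z 3 + 1 : OS7) * h

/-! ### The deformed algebras -/

/-- The algebra `𝒪(S⁷_θ)`, the twist of `𝒪(S⁷)` by the two-cocycle `σ` on `𝒪(𝕋²)`. -/
abbrev OS7Theta (θ : ℝ) : Type := Twisted leftS7 (sigma θ)

/-- The algebra `𝒪(S⁴_θ)`, the twist of `𝒪(S⁴)` by the two-cocycle `σ` on `𝒪(𝕋²)`. -/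
abbrev OS4Theta (θ : ℝ) : Type := Twisted leftS4 (sigma θ)

/-- `𝒪(S⁷_θ)` as a right `𝒪(SU(2))`-comodule algebra, with the coaction of `𝒪(S⁷)`. -/
def rightS7Theta (θ : ℝ) : RightComoduleAlgebra ℂ OSU2 (OS7Theta θ) :=
  rightS7.twist leftS7 coactionsCommute_S7 (sigma θ)

end InstantonBundle

end

/-! Write B for the coinvariants of A. The argument rests on the Haar integral h of 𝒪(SU(2)), which
makes the Hopf algebra cosemisimple. For a Hopf algebra with such an integral, surjectivity of the
canonical map is enough for principality (`isPrincipal_of_integral`). The expectation a ↦ a₍₀₎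
h(a₍₁₎) is a B-linear projection onto B. Applied to the first leg of a₍₀₎ ℓ(a₍₁₎), with ℓ a linear
lift of g ↦ 1 ⊗ g through the canonical map, it gives a B-linear section of the product B ⊗ A → A.
As a map into A ⊗ A this section depends on a only through its coaction, in a left A-linear way, so
it also provides a left inverse of the canonical map. Averaging with a ⊗ g ↦ a₍₀₎ h(a₍₁₎ S(g)) makes
the section colinear.

The g with 1 ⊗ g in the range of the canonical map form a subalgebra, so surjectivity is checked on
the entries of T. There the classical lift ∑ₖ (u⁻¹)ᵢₖ ⊗ uₖⱼ survives the deformation: the two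
factors have opposite torus degrees, and σ is 1 on opposite degrees because Θ is antisymmetric.

The integral is given on monomials, and its invariance is checked on powers of linear forms, which
span. The integral of the n-th power of a linear form is a constant depending on n only, times a
power of a quadratic form in the coefficients (`slice_haar_pow`), and that quadratic form is
SU(2)-invariant.

The same formula finds the coinvariants. A coinvariant is its own average, and the average of a
power of a linear form on S⁷ is a multiple of a power of a combination of 2 × 2 minors of u, all of
which lie in the image of ι. For injectivity, ι is split after inverting the non-zero-divisor α.
Twisting changes neither the vector spaces nor the coaction of 𝒪(SU(2)), and ι preserves torus
degrees, so these statements pass to the deformed algebras. -/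

open scoped TensorProduct

noncomputable section

namespace HopfGalois

universe u v w x

/-! ### Hopf algebras with an invariant integral -/

section Integral

variable {k : Type u} [Field k] {H : Type v} [Ring H] [HopfAlgebra k H]

/-- The slice map `M ⊗ H → M`, `m ⊗ g ↦ h(g) m` of a functional `h` on `H`. -/
def slice (M : Type w) [AddCommGroup M] [Module k M] (h : H →ₗ[k] k) : M ⊗[k] H →ₗ[k] M :=
  (TensorProduct.rid k M).toLinearMap ∘ₗ h.lTensor M

@[simp]
theorem slice_tmul {M : Type w} [AddCommGroup M] [Module k M] (h : H →ₗ[k] k) (m : M) (g : H) :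
    slice M h (m ⊗ₜ g) = h g • m := by
  simp [slice]

theorem slice_tmul_one_mul {A : Type w} [Ring A] [Algebra k A] (h : H →ₗ[k] k) (b : A)
    (p : A ⊗[k] H) : slice A h ((b ⊗ₜ 1) * p) = b * slice A h p := by
  induction p with
  | zero => simp
  | add p q hp hq => simp only [mul_add, map_add, hp, hq]
  | tmul a g => simp

theorem slice_mul_tmul_one {A : Type w} [Ring A] [Algebra k A] (h : H →ₗ[k] k) (b : A)
    (p : A ⊗[k] H) : slice A h (p * (b ⊗ₜ 1)) = slice A h p * b := by
  induction p with
  | zero => simp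
  | add p q hp hq => simp only [add_mul, map_add, hp, hq]
  | tmul a g => simp

/-- A normalised right-invariant integral on a Hopf algebra whose antipode is a bijective
anti-morphism of coalgebras. -/
structure Integral (h : H →ₗ[k] k) : Prop where
  map_one : h 1 = 1
  invariant : ∀ g : H, slice H h (Coalgebra.comul (R := k) g) = h g • (1 : H)
  comul_antipode : ∀ g : H, Coalgebra.comul (R := k) (HopfAlgebra.antipode k g) =
    TensorProduct.comm k H H (TensorProduct.map (HopfAlgebra.antipode k)
      (HopfAlgebra.antipode k) (Coalgebra.comul (R := k) g))

variable {h : H →ₗ[k] k}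

/-- `h(f S(g₍₁₎)) g₍₂₎ = f₍₁₎ h(f₍₂₎ S(g))`. -/
theorem Integral.slice_comul_mul_antipode (hh : Integral h) (f g : H) :
    slice H h (Coalgebra.comul (R := k) f * (1 ⊗ₜ HopfAlgebra.antipode k g)) =
      TensorProduct.lid k H ((h ∘ₗ LinearMap.mulLeft k f ∘ₗ HopfAlgebra.antipode k).rTensor H
        (Coalgebra.comul (R := k) g)) := by
  -- Ψ sends a ⊗ b ⊗ c to (id ⊗ h)(Δ(f)(S(b)c ⊗ S(a))). It is evaluated on g₍₁₎ ⊗ g₍₂₎ ⊗ g₍₃₎ in two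
  -- ways: g₍₁₎, g₍₂₎ together give an invariant integral, while g₍₂₎, g₍₃₎ together cancel by the
  -- antipode axiom.
  let Ψ : H ⊗[k] (H ⊗[k] H) →ₗ[k] H :=
    slice H h ∘ₗ LinearMap.mulLeft k (Coalgebra.comul (R := k) f) ∘ₗ
      (TensorProduct.comm k H H).toLinearMap ∘ₗ
        TensorProduct.map (HopfAlgebra.antipode k)
          (LinearMap.mul' k H ∘ₗ (HopfAlgebra.antipode k).rTensor H)
  have h1 : ∀ q : H ⊗[k] H, TensorProduct.lid k H
      ((h ∘ₗ LinearMap.mulLeft k f ∘ₗ HopfAlgebra.antipode k).rTensor H q) =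
        Ψ (TensorProduct.assoc k H H H ((Coalgebra.comul (R := k)).rTensor H q)) := by
    intro q
    induction q with
    | zero => simp
    | add p q hp hq => simp only [map_add, hp, hq]
    | tmul a c =>
      have h2 : ∀ r : H ⊗[k] H, Ψ (TensorProduct.assoc k H H H (r ⊗ₜ c)) =
          slice H h (Coalgebra.comul (R := k) f * TensorProduct.comm k H H (TensorProduct.map
            (HopfAlgebra.antipode k) (HopfAlgebra.antipode k) r)) * c := by
        intro r
        rw [← slice_mul_tmul_one]
        induction r with
        | zero => simp
        | add p q hp hq => simp only [TensorProduct.add_tmul, map_add, mul_add, add_mul, hp, hq]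
        | tmul a b => simp [Ψ, mul_assoc]
      -- Since S reverses the coproduct, the flipped factors reassemble to Δ(f S(a)), to which
      -- invariance of h applies.
      rw [LinearMap.rTensor_tmul, LinearMap.rTensor_tmul, h2, ← hh.comul_antipode,
        ← Bialgebra.comul_mul, hh.invariant]
      simp
  have h3 : ∀ q : H ⊗[k] H, Ψ ((Coalgebra.comul (R := k)).lTensor H q) =
      slice H h (Coalgebra.comul (R := k) f *
        (1 ⊗ₜ HopfAlgebra.antipode k (slice H (Coalgebra.counit (R := k)) q))) := by
    intro q
    induction q with
    | zero => simp
    | add p q hp hq => simp only [map_add, TensorProduct.tmul_add, mul_add, hp, hq]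
    | tmul a b =>
      simp [Ψ, HopfAlgebra.mul_antipode_rTensor_comul_apply, Algebra.algebraMap_eq_smul_one]
  rw [h1, Coalgebra.coassoc_apply, h3]
  simp [slice]

end Integral

/-! ### Expectation and averaging on a comodule algebra -/

namespace RightComoduleAlgebra

variable {k : Type u} [Field k] {H : Type v} {A : Type w} [Ring H] [HopfAlgebra k H] [Ring A]
  [Algebra k A] (δ : RightComoduleAlgebra k H A)

/-- The map `A ⊗ H → A ⊗ H`, `a ⊗ g ↦ a₍₀₎ ⊗ a₍₁₎ S(g)`. -/
def untwist : A ⊗[k] H →ₗ[k] A ⊗[k] H :=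
  LinearMap.mul' k (A ⊗[k] H) ∘ₗ TensorProduct.map δ.coact.toLinearMap
    ((Algebra.TensorProduct.includeRight : H →ₐ[k] A ⊗[k] H).toLinearMap ∘ₗ
      HopfAlgebra.antipode k)

theorem untwist_tmul (a : A) (g : H) :
    δ.untwist (a ⊗ₜ g) = δ.coact a * (1 ⊗ₜ HopfAlgebra.antipode k g) := by
  simp [untwist]

/-- By coassociativity the left side is a₍₀₎ ⊗ a₍₁₎ S(a₍₂₎), and the antipode axiom applies. -/
theorem untwist_coact (a : A) : δ.untwist (δ.coact a) = a ⊗ₜ 1 := by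
  let F : A ⊗[k] (H ⊗[k] H) →ₗ[k] A ⊗[k] H :=
    (LinearMap.mul' k H ∘ₗ (HopfAlgebra.antipode k).lTensor H).lTensor A
  have h1 : ∀ p : A ⊗[k] H, δ.untwist p =
      F (TensorProduct.assoc k A H H (δ.coact.toLinearMap.rTensor H p)) := by
    intro p
    induction p with
    | zero => simp
    | add p q hp hq => simp only [map_add, hp, hq]
    | tmul a g =>
      rw [untwist_tmul, LinearMap.rTensor_tmul, AlgHom.toLinearMap_apply]
      generalize δ.coact a = q
      induction q with
      | zero => simp
      | add p q hp hq => simp only [TensorProduct.add_tmul, map_add, add_mul, hp, hq]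
      | tmul b f => simp [F]
  have h2 : ∀ p : A ⊗[k] H, F ((Coalgebra.comul (R := k)).lTensor A p) =
      (TensorProduct.rid k A ((Coalgebra.counit (R := k) (A := H)).lTensor A p)) ⊗ₜ 1 := by
    intro p
    induction p with
    | zero => simp
    | add p q hp hq => simp only [map_add, TensorProduct.add_tmul, hp, hq]
    | tmul a g =>
      simp [F, HopfAlgebra.mul_antipode_lTensor_comul_apply, Algebra.algebraMap_eq_smul_one,
        TensorProduct.smul_tmul]
  rw [h1, ← δ.coassoc, h2, δ.counit]

theorem untwist_tmul_one_mul (a : A) (p : A ⊗[k] H) :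
    δ.untwist ((a ⊗ₜ 1) * p) = δ.coact a * δ.untwist p := by
  induction p with
  | zero => simp
  | add p q hp hq => simp only [mul_add, map_add, hp, hq]
  | tmul b g => simp [untwist_tmul, mul_assoc]

/-- Untwisting carries the canonical map to a ⊗ b ↦ a₍₀₎ b ⊗ a₍₁₎. Integrating the second leg then
yields the expectation of a, multiplied by b. -/
theorem untwist_preCanonicalMap (a b : A) :
    δ.untwist (δ.preCanonicalMap (a ⊗ₜ b)) = δ.coact a * (b ⊗ₜ 1) := by
  rw [preCanonicalMap_tmul, untwist_tmul_one_mul, untwist_coact]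

theorem preCanonicalMap_tmul_one_mul (a : A) (t : A ⊗[k] A) :
    δ.preCanonicalMap ((a ⊗ₜ 1) * t) = (a ⊗ₜ 1) * δ.preCanonicalMap t := by
  induction t with
  | zero => simp
  | add p q hp hq => simp only [mul_add, map_add, hp, hq]
  | tmul b c =>
    simp only [Algebra.TensorProduct.tmul_mul_tmul, one_mul, preCanonicalMap_tmul, ← mul_assoc]

theorem coact_slice (h : H →ₗ[k] k) (p : A ⊗[k] H) :
    δ.coact (slice A h p) =
      (slice H h).lTensor A (TensorProduct.assoc k A H H (δ.coact.toLinearMap.rTensor H p)) := by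
  induction p with
  | zero => simp
  | add p q hp hq => simp only [map_add, hp, hq]
  | tmul a g =>
    rw [slice_tmul, map_smul, LinearMap.rTensor_tmul, AlgHom.toLinearMap_apply]
    generalize δ.coact a = q
    induction q with
    | zero => simp
    | add p q hp hq => simp only [TensorProduct.add_tmul, map_add, smul_add, hp, hq]
    | tmul b f => simp

theorem coact_coinvariant_mul (b : δ.coinvariants) (a : A) :
    δ.coact (b * a) = ((b : A) ⊗ₜ 1) * δ.coact a := by
  rw [map_mul, δ.mem_coinvariants.1 b.2]

variable {h : H →ₗ[k] k}

/-- The coaction of a₍₀₎ h(a₍₁₎) is a₍₀₎ ⊗ a₍₁₎ h(a₍₂₎), and invariance of h replaces the second leg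
by a multiple of 1. -/
theorem slice_coact_mem (hh : Integral h) (a : A) : slice A h (δ.coact a) ∈ δ.coinvariants := by
  rw [mem_coinvariants, coact_slice, ← δ.coassoc]
  generalize δ.coact a = p
  induction p with
  | zero => simp
  | add p q hp hq => simp only [map_add, TensorProduct.add_tmul, hp, hq]
  | tmul a g => simp [hh.invariant, TensorProduct.smul_tmul]

/-- The projection `A → A^{co H}`, `a ↦ a₍₀₎ h(a₍₁₎)`. -/
def expectation (hh : Integral h) : A →ₗ[k] δ.coinvariants :=
  LinearMap.codRestrict (Subalgebra.toSubmodule δ.coinvariants)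
    (slice A h ∘ₗ δ.coact.toLinearMap) (δ.slice_coact_mem hh)

theorem coe_expectation (hh : Integral h) (a : A) :
    (δ.expectation hh a : A) = slice A h (δ.coact a) := rfl

theorem expectation_mul (hh : Integral h) (b : δ.coinvariants) (a : A) :
    δ.expectation hh (b * a) = b * δ.expectation hh a := by
  apply Subtype.ext
  rw [Subalgebra.coe_mul, coe_expectation, coe_expectation, coact_coinvariant_mul,
    slice_tmul_one_mul]

/-- The averaging map `A ⊗ H → A`, `a ⊗ g ↦ a₍₀₎ h(a₍₁₎ S(g))`. -/
def average (h : H →ₗ[k] k) : A ⊗[k] H →ₗ[k] A := slice A h ∘ₗ δ.untwist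

/-- With `coact_average` this makes the averaging map a colinear retraction of δ, where H coacts on
A ⊗ H through the second factor. -/
theorem average_coact (hh : Integral h) (a : A) : δ.average h (δ.coact a) = a := by
  simp [average, untwist_coact, hh.map_one]

theorem average_coinvariant_mul (b : δ.coinvariants) (t : A ⊗[k] H) :
    δ.average h (((b : A) ⊗ₜ 1) * t) = b * δ.average h t := by
  rw [average, LinearMap.comp_apply, LinearMap.comp_apply, untwist_tmul_one_mul,
    δ.mem_coinvariants.1 b.2, slice_tmul_one_mul]

/-- On a ⊗ g the left side is a₍₀₎ ⊗ a₍₁₎ h(a₍₂₎ S(g)). The identity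
`Integral.slice_comul_mul_antipode` with f = a₍₁₎ turns it into a₍₀₎ h(a₍₁₎ S(g₍₁₎)) ⊗ g₍₂₎. -/
theorem coact_average (hh : Integral h) (t : A ⊗[k] H) :
    δ.coact (δ.average h t) = (δ.average h).rTensor H
      ((TensorProduct.assoc k A H H).symm ((Coalgebra.comul (R := k)).lTensor A t)) := by
  induction t with
  | zero => simp
  | add p q hp hq => simp only [map_add, hp, hq]
  | tmul a g =>
    have h1 : ∀ p : A ⊗[k] H, TensorProduct.assoc k A H H (δ.coact.toLinearMap.rTensor H
        (p * (1 ⊗ₜ HopfAlgebra.antipode k g))) =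
        TensorProduct.assoc k A H H (δ.coact.toLinearMap.rTensor H p) *
          (1 ⊗ₜ (1 ⊗ₜ HopfAlgebra.antipode k g)) := by
      intro p
      induction p with
      | zero => simp
      | add p q hp hq => simp only [add_mul, map_add, hp, hq]
      | tmul a f =>
        simp only [Algebra.TensorProduct.tmul_mul_tmul, mul_one, LinearMap.rTensor_tmul,
          AlgHom.toLinearMap_apply]
        generalize δ.coact a = q
        induction q with
        | zero => simp
        | add p q hp hq => simp only [TensorProduct.add_tmul, add_mul, map_add, hp, hq]
        | tmul b f => simp
    have h2 : ∀ p : A ⊗[k] H, (slice H h).lTensor A ((Coalgebra.comul (R := k)).lTensor A p *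
        (1 ⊗ₜ (1 ⊗ₜ HopfAlgebra.antipode k g))) =
        (slice A h ∘ₗ LinearMap.mulLeft k p ∘ₗ
          (Algebra.TensorProduct.includeRight : H →ₐ[k] A ⊗[k] H).toLinearMap ∘ₗ
            HopfAlgebra.antipode k).rTensor H (Coalgebra.comul (R := k) g) := by
      intro p
      induction p with
      | zero => simp
      | add p q hp hq =>
        simp only [add_mul, map_add, hp, hq, ← LinearMap.add_apply, ← LinearMap.rTensor_add]
        congr 2
        ext
        simp [add_mul]
      | tmul a f =>
        rw [LinearMap.lTensor_tmul, Algebra.TensorProduct.tmul_mul_tmul, LinearMap.lTensor_tmul,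
          hh.slice_comul_mul_antipode]
        generalize Coalgebra.comul (R := k) g = r
        induction r with
        | zero => simp
        | add p q hp hq => simp only [TensorProduct.tmul_add, map_add, hp, hq]
        | tmul b c => simp [TensorProduct.smul_tmul]
    rw [average, LinearMap.comp_apply, coact_slice, untwist_tmul, h1, ← δ.coassoc, h2,
      LinearMap.lTensor_tmul]
    generalize Coalgebra.comul (R := k) g = r
    induction r with
    | zero => simp
    | add p q hp hq => simp only [TensorProduct.tmul_add, map_add, hp, hq]
    | tmul b c => simp [untwist_tmul]

/-! ### The linear splitting attached to a lift of the canonical map -/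

/-- For `ℓ : H → A ⊗ A`, the map `A ⊗ H → A ⊗ A`, `a ⊗ g ↦ a ℓ(g)`. -/
def leftExtend (ℓ : H →ₗ[k] A ⊗[k] A) : A ⊗[k] H →ₗ[k] A ⊗[k] A :=
  LinearMap.mul' k (A ⊗[k] A) ∘ₗ TensorProduct.map
    (Algebra.TensorProduct.includeLeft : A →ₐ[k] A ⊗[k] A).toLinearMap ℓ

theorem leftExtend_tmul (ℓ : H →ₗ[k] A ⊗[k] A) (a : A) (g : H) :
    leftExtend ℓ (a ⊗ₜ g) = (a ⊗ₜ 1) * ℓ g := by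
  simp [leftExtend]

theorem leftExtend_tmul_one_mul (ℓ : H →ₗ[k] A ⊗[k] A) (a : A) (p : A ⊗[k] H) :
    leftExtend ℓ ((a ⊗ₜ 1) * p) = (a ⊗ₜ 1) * leftExtend ℓ p := by
  induction p with
  | zero => simp
  | add p q hp hq => simp only [mul_add, map_add, hp, hq]
  | tmul b g => simp [leftExtend_tmul, ← mul_assoc]

theorem preCanonicalMap_leftExtend {ℓ : H →ₗ[k] A ⊗[k] A}
    (hℓ : ∀ g, δ.preCanonicalMap (ℓ g) = 1 ⊗ₜ g) (p : A ⊗[k] H) :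
    δ.preCanonicalMap (leftExtend ℓ p) = p := by
  induction p with
  | zero => simp
  | add p q hp hq => simp only [map_add, hp, hq]
  | tmul a g => simp [leftExtend_tmul, preCanonicalMap_tmul_one_mul, hℓ]

/-- For `ℓ : H → A ⊗ A`, the map `A → A^{co H} ⊗ A` sending `a` to `a₍₀₎ ℓ(a₍₁₎)` with the
expectation applied to its first leg. -/
def splitting (hh : Integral h) (ℓ : H →ₗ[k] A ⊗[k] A) : A →ₗ[k] δ.coinvariants ⊗[k] A :=
  (δ.expectation hh).rTensor A ∘ₗ leftExtend ℓ ∘ₗ δ.coact.toLinearMap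

theorem splitting_mul (hh : Integral h) (ℓ : H →ₗ[k] A ⊗[k] A) (b : δ.coinvariants) (a : A) :
    δ.splitting hh ℓ (b * a) = (b ⊗ₜ 1) * δ.splitting hh ℓ a := by
  have h1 : ∀ t : A ⊗[k] A, (δ.expectation hh).rTensor A (((b : A) ⊗ₜ 1) * t) =
      (b ⊗ₜ 1) * (δ.expectation hh).rTensor A t := by
    intro t
    induction t with
    | zero => simp
    | add p q hp hq => simp only [mul_add, map_add, hp, hq]
    | tmul a c => simp [expectation_mul]
  simp only [splitting, LinearMap.comp_apply, AlgHom.toLinearMap_apply, coact_coinvariant_mul,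
    leftExtend_tmul_one_mul, h1]

/-- Multiplying after taking the expectation of the first leg is the averaging map composed with the
canonical map. The lift ℓ cancels the canonical map, and averaging cancels δ. -/
theorem mul_splitting (hh : Integral h) {ℓ : H →ₗ[k] A ⊗[k] A}
    (hℓ : ∀ g, δ.preCanonicalMap (ℓ g) = 1 ⊗ₜ g) (a : A) :
    LinearMap.mul' k A (δ.coinvariants.val.toLinearMap.rTensor A (δ.splitting hh ℓ a)) = a := by
  have h1 : ∀ t : A ⊗[k] A, LinearMap.mul' k A (δ.coinvariants.val.toLinearMap.rTensor A
      ((δ.expectation hh).rTensor A t)) = δ.average h (δ.preCanonicalMap t) := by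
    intro t
    induction t with
    | zero => simp
    | add p q hp hq => simp only [map_add, hp, hq]
    | tmul a c =>
      rw [average, LinearMap.comp_apply, untwist_preCanonicalMap, slice_mul_tmul_one]
      simp [coe_expectation]
  simp only [splitting, LinearMap.comp_apply, AlgHom.toLinearMap_apply, h1,
    δ.preCanonicalMap_leftExtend hℓ, δ.average_coact hh]

/-- The map `H ⊗ (A ⊗ A) → A ⊗ A`, `g ⊗ (a ⊗ c) ↦ h(g a₍₁₎) a₍₀₎ ⊗ c`. -/
def sliceLeft (h : H →ₗ[k] k) : H ⊗[k] (A ⊗[k] A) →ₗ[k] A ⊗[k] A :=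
  (slice A h ∘ₗ LinearMap.mul' k (A ⊗[k] H) ∘ₗ TensorProduct.map
    (Algebra.TensorProduct.includeRight : H →ₐ[k] A ⊗[k] H).toLinearMap
      δ.coact.toLinearMap).rTensor A ∘ₗ (TensorProduct.assoc k H A A).symm.toLinearMap

theorem sliceLeft_tmul (g : H) (a c : A) :
    δ.sliceLeft h (g ⊗ₜ (a ⊗ₜ c)) = slice A h ((1 ⊗ₜ g) * δ.coact a) ⊗ₜ c := by
  simp [sliceLeft]

/-- `splitting` depends only on the coaction of its argument, by a left `A`-linear map. -/
theorem val_splitting (hh : Integral h) (ℓ : H →ₗ[k] A ⊗[k] A) (a : A) :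
    δ.coinvariants.val.toLinearMap.rTensor A (δ.splitting hh ℓ a) =
      leftExtend (δ.sliceLeft h ∘ₗ ℓ.lTensor H ∘ₗ Coalgebra.comul (R := k)) (δ.coact a) := by
  -- The expectation of a product ab is a₍₀₎ b₍₀₎ h(a₍₁₎ b₍₁₎), so a₍₀₎ comes out on the left.
  -- Coassociativity moves the remaining a₍₁₎ into the coproduct of the H-leg.
  let F : A ⊗[k] (H ⊗[k] H) →ₗ[k] A ⊗[k] A :=
    LinearMap.mul' k (A ⊗[k] A) ∘ₗ TensorProduct.map
      (Algebra.TensorProduct.includeLeft : A →ₐ[k] A ⊗[k] A).toLinearMap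
        (δ.sliceLeft h ∘ₗ ℓ.lTensor H)
  have h1 : ∀ p : A ⊗[k] H, δ.coinvariants.val.toLinearMap.rTensor A
      ((δ.expectation hh).rTensor A (leftExtend ℓ p)) =
        F (TensorProduct.assoc k A H H (δ.coact.toLinearMap.rTensor H p)) := by
    intro p
    induction p with
    | zero => simp
    | add p q hp hq => simp only [map_add, hp, hq]
    | tmul a g =>
      have h2 : ∀ q : A ⊗[k] H, F (TensorProduct.assoc k A H H (q ⊗ₜ g)) =
          LinearMap.mul' k (A ⊗[k] A) (TensorProduct.map
            (Algebra.TensorProduct.includeLeft : A →ₐ[k] A ⊗[k] A).toLinearMap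
            (δ.sliceLeft h ∘ₗ (TensorProduct.mk k H (A ⊗[k] A)).flip (ℓ g)) q) := by
        intro q
        induction q with
        | zero => simp
        | add p q hp hq => simp only [TensorProduct.add_tmul, map_add, hp, hq]
        | tmul b f => simp [F]
      rw [leftExtend_tmul, LinearMap.rTensor_tmul, h2, AlgHom.toLinearMap_apply]
      generalize ℓ g = t
      induction t with
      | zero => simp
      | add p q hp hq =>
        simp only [mul_add, map_add, hp, hq, LinearMap.comp_add, TensorProduct.map_add_right,
          LinearMap.add_apply]
      | tmul b c =>
        rw [Algebra.TensorProduct.tmul_mul_tmul, LinearMap.rTensor_tmul, LinearMap.rTensor_tmul,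
          AlgHom.toLinearMap_apply, Subalgebra.coe_val, coe_expectation, map_mul, one_mul]
        generalize δ.coact a = q
        induction q with
        | zero => simp
        | add p q hp hq => simp only [add_mul, TensorProduct.add_tmul, map_add, hp, hq]
        | tmul x g =>
          have : (x ⊗ₜ[k] g : A ⊗[k] H) = (x ⊗ₜ 1) * (1 ⊗ₜ g) := by simp
          rw [this, mul_assoc, slice_tmul_one_mul]
          simp [sliceLeft_tmul]
  have h3 : ∀ p : A ⊗[k] H, F ((Coalgebra.comul (R := k)).lTensor A p) =
      leftExtend (δ.sliceLeft h ∘ₗ ℓ.lTensor H ∘ₗ Coalgebra.comul (R := k)) p := by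
    intro p
    induction p with
    | zero => simp
    | add p q hp hq => simp only [map_add, hp, hq]
    | tmul a g => simp [F, leftExtend_tmul]
  rw [splitting, LinearMap.comp_apply, LinearMap.comp_apply, h1, AlgHom.toLinearMap_apply,
    ← δ.coassoc, h3]

/-! ### Making the splitting colinear -/

/-- A map `f : A → A^{co H} ⊗ A` made right `H`-colinear by averaging. -/
def averagedSplitting (h : H →ₗ[k] k) (f : A →ₗ[k] δ.coinvariants ⊗[k] A) :
    A →ₗ[k] δ.coinvariants ⊗[k] A :=
  (δ.average h).lTensor δ.coinvariants ∘ₗ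
    (TensorProduct.assoc k δ.coinvariants A H).toLinearMap ∘ₗ f.rTensor H ∘ₗ
      δ.coact.toLinearMap

set_option synthInstance.maxHeartbeats 200000 in
theorem averagedSplitting_mul {f : A →ₗ[k] δ.coinvariants ⊗[k] A}
    (hf : ∀ (b : δ.coinvariants) (a : A), f (b * a) = (b ⊗ₜ 1) * f a)
    (b : δ.coinvariants) (a : A) :
    δ.averagedSplitting h f (b * a) = (b ⊗ₜ 1) * δ.averagedSplitting h f a := by
  simp only [averagedSplitting, LinearMap.comp_apply, AlgHom.toLinearMap_apply,
    coact_coinvariant_mul, LinearEquiv.coe_coe]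
  generalize δ.coact a = p
  induction p with
  | zero => simp
  | add p q hp hq => simp only [mul_add, map_add, hp, hq]
  | tmul a g =>
    rw [Algebra.TensorProduct.tmul_mul_tmul, LinearMap.rTensor_tmul, LinearMap.rTensor_tmul, hf,
      one_mul]
    generalize f a = t
    induction t with
    | zero => simp
    | add p q hp hq => simp only [mul_add, TensorProduct.add_tmul, map_add, hp, hq]
    | tmul c d => simp

set_option synthInstance.maxHeartbeats 200000 in
-- Averaging is linear over the coinvariants, so it commutes with the product and the claim becomes
-- `average_coact`.
theorem mul_averagedSplitting (hh : Integral h) {f : A →ₗ[k] δ.coinvariants ⊗[k] A}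
    (hf : ∀ a : A, LinearMap.mul' k A (δ.coinvariants.val.toLinearMap.rTensor A (f a)) = a)
    (a : A) : LinearMap.mul' k A (δ.coinvariants.val.toLinearMap.rTensor A
      (δ.averagedSplitting h f a)) = a := by
  have h1 : ∀ p : A ⊗[k] H, LinearMap.mul' k A (δ.coinvariants.val.toLinearMap.rTensor A
      ((δ.average h).lTensor δ.coinvariants (TensorProduct.assoc k δ.coinvariants A H
        (f.rTensor H p)))) = δ.average h p := by
    intro p
    induction p with
    | zero => simp
    | add p q hp hq => simp only [map_add, hp, hq]
    | tmul a g =>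
      conv_rhs => rw [← hf a]
      rw [LinearMap.rTensor_tmul]
      generalize f a = t
      induction t with
      | zero => simp
      | add p q hp hq => simp only [TensorProduct.add_tmul, map_add, hp, hq]
      | tmul c d => simp [← δ.average_coinvariant_mul]
  simp only [averagedSplitting, LinearMap.comp_apply, AlgHom.toLinearMap_apply,
    LinearEquiv.coe_coe, h1, δ.average_coact hh]

set_option synthInstance.maxHeartbeats 200000 in
-- The averaged map sends a to the average of f(a₍₀₎) ⊗ a₍₁₎. Its colinearity comes from that of
-- averaging and the coassociativity of δ; nothing is asked of f beyond linearity.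
theorem averagedSplitting_colinear (hh : Integral h) (f : A →ₗ[k] δ.coinvariants ⊗[k] A)
    (a : A) : TensorProduct.assoc k δ.coinvariants A H
      ((δ.averagedSplitting h f).rTensor H (δ.coact a)) =
        δ.coact.toLinearMap.lTensor δ.coinvariants (δ.averagedSplitting h f a) := by
  let G : A ⊗[k] H →ₗ[k] δ.coinvariants ⊗[k] A := (δ.average h).lTensor δ.coinvariants ∘ₗ
    (TensorProduct.assoc k δ.coinvariants A H).toLinearMap ∘ₗ f.rTensor H
  let F : A ⊗[k] (H ⊗[k] H) →ₗ[k] δ.coinvariants ⊗[k] (A ⊗[k] H) :=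
    (TensorProduct.assoc k δ.coinvariants A H).toLinearMap ∘ₗ G.rTensor H ∘ₗ
      (TensorProduct.assoc k A H H).symm.toLinearMap
  have h1 : ∀ p : A ⊗[k] H, TensorProduct.assoc k δ.coinvariants A H
      ((δ.averagedSplitting h f).rTensor H p) =
        F (TensorProduct.assoc k A H H (δ.coact.toLinearMap.rTensor H p)) := by
    intro p
    have : δ.averagedSplitting h f = G ∘ₗ δ.coact.toLinearMap := rfl
    simp only [F, this, LinearMap.rTensor_comp, LinearMap.comp_apply, LinearEquiv.coe_coe,
      LinearEquiv.symm_apply_apply]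
  have h2 : ∀ p : A ⊗[k] H, F ((Coalgebra.comul (R := k)).lTensor A p) =
      δ.coact.toLinearMap.lTensor δ.coinvariants (G p) := by
    intro p
    induction p with
    | zero => simp
    | add p q hp hq => simp only [map_add, hp, hq]
    | tmul a g =>
      have h3 : ∀ r : H ⊗[k] H, F (a ⊗ₜ r) = ((δ.average h).rTensor H ∘ₗ
          (TensorProduct.assoc k A H H).symm.toLinearMap).lTensor δ.coinvariants
            (TensorProduct.assoc k δ.coinvariants A (H ⊗[k] H) (f a ⊗ₜ r)) := by
        intro r
        induction r with
        | zero => simp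
        | add p q hp hq => simp only [TensorProduct.tmul_add, map_add, hp, hq]
        | tmul g g' =>
          simp only [F, G, LinearMap.comp_apply, LinearEquiv.coe_coe, LinearMap.rTensor_tmul,
            TensorProduct.assoc_symm_tmul]
          generalize f a = t
          induction t with
          | zero => simp
          | add p q hp hq => simp only [TensorProduct.add_tmul, map_add, hp, hq]
          | tmul c d => simp
      rw [LinearMap.lTensor_tmul, h3]
      simp only [G, LinearMap.comp_apply, LinearEquiv.coe_coe, LinearMap.rTensor_tmul]
      generalize f a = t
      induction t with
      | zero => simp
      | add p q hp hq => simp only [TensorProduct.add_tmul, map_add, hp, hq]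
      | tmul c d => simp [δ.coact_average hh]
  rw [h1, ← δ.coassoc, h2]
  rfl

/-! ### Principality from surjectivity of the canonical map -/

/-- If `H` has an invariant integral and the canonical map is surjective, then `A` is a principal
`H`-comodule algebra. -/
theorem isPrincipal_of_integral (hh : Integral h)
    (hS : Function.Bijective (HopfAlgebra.antipode k (A := H)))
    (hχ : ∀ g : H, (1 : A) ⊗ₜ[k] g ∈ LinearMap.range δ.preCanonicalMap) : δ.IsPrincipal := by
  have hsurj : Function.Surjective δ.preCanonicalMap := by
    intro p
    induction p with
    | zero => exact ⟨0, map_zero _⟩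
    | add p q hp hq =>
      obtain ⟨s, rfl⟩ := hp
      obtain ⟨t, rfl⟩ := hq
      exact ⟨s + t, map_add _ _ _⟩
    | tmul a g =>
      obtain ⟨t, ht⟩ := hχ g
      exact ⟨(a ⊗ₜ 1) * t, by rw [preCanonicalMap_tmul_one_mul, ht]; simp⟩
  -- Over a field a surjection has a linear section. The resulting ℓ need not be colinear.
  obtain ⟨r, hr⟩ := δ.preCanonicalMap.exists_rightInverse_of_surjective
    (LinearMap.range_eq_top.2 hsurj)
  obtain ⟨ℓ, hℓ⟩ : ∃ ℓ : H →ₗ[k] A ⊗[k] A, ∀ g, δ.preCanonicalMap (ℓ g) = 1 ⊗ₜ g :=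
    ⟨r ∘ₗ TensorProduct.mk k A H 1, fun g => LinearMap.congr_fun hr (1 ⊗ₜ g)⟩
  refine ⟨hS, ⟨?_, ?_⟩, δ.averagedSplitting h (δ.splitting hh ℓ),
    δ.averagedSplitting_mul (δ.splitting_mul hh ℓ),
    δ.averagedSplitting_colinear hh _, δ.mul_averagedSplitting hh (δ.mul_splitting hh hℓ)⟩
  -- Λ induces a left inverse of the canonical map. In the balanced tensor product, writing c as the
  -- product of its splitting ∑ bᵢ ⊗ dᵢ gives a ⊗ c = ∑ a bᵢ ⊗ dᵢ, and `val_splitting` identifies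
  -- the right side with Λ(a c₍₀₎ ⊗ c₍₁₎).
  · let Λ := leftExtend (δ.sliceLeft h ∘ₗ ℓ.lTensor H ∘ₗ Coalgebra.comul (R := k))
    have h1 : ∀ t : A ⊗[k] A, (balancedRelations δ.coinvariants).mkQ t =
        (balancedRelations δ.coinvariants).mkQ (Λ (δ.preCanonicalMap t)) := by
      intro t
      induction t with
      | zero => simp
      | add p q hp hq => simp only [map_add, hp, hq]
      | tmul a c =>
        rw [preCanonicalMap_tmul, leftExtend_tmul_one_mul, ← δ.val_splitting hh]
        conv_lhs => rw [← δ.mul_splitting hh hℓ c]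
        generalize δ.splitting hh ℓ c = t
        induction t with
        | zero => simp
        | add p q hp hq => simp only [map_add, TensorProduct.tmul_add, mul_add, hp, hq]
        | tmul b d =>
          symm
          rw [← sub_eq_zero, ← map_sub, Submodule.mkQ_apply, Submodule.Quotient.mk_eq_zero]
          exact Submodule.subset_span ⟨a, b, b.2, d, by simp⟩
    refine (injective_iff_map_eq_zero _).2 fun q hq => ?_
    obtain ⟨t, rfl⟩ := Submodule.mkQ_surjective _ q
    have hq' : δ.preCanonicalMap t = 0 := hq
    rw [h1, hq', map_zero, map_zero]
  · intro p
    obtain ⟨t, rfl⟩ := hsurj p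
    exact ⟨(balancedRelations δ.coinvariants).mkQ t, rfl⟩

/-- The elements `g` of `H` with `1 ⊗ g` in the range of the canonical map form a subalgebra. -/
def canonicalSubalgebra : Subalgebra k H where
  carrier := {g | (1 : A) ⊗ₜ[k] g ∈ LinearMap.range δ.preCanonicalMap}
  algebraMap_mem' c := ⟨c • (1 ⊗ₜ 1), by
    rw [map_smul, preCanonicalMap_tmul, map_one, mul_one, Algebra.algebraMap_eq_smul_one,
      TensorProduct.tmul_smul]⟩
  add_mem' {a b} ha hb := by
    rw [Set.mem_ofPred_eq, TensorProduct.tmul_add]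
    exact add_mem ha hb
  mul_mem' {a b} ha hb := by
    obtain ⟨s, hs⟩ := ha
    obtain ⟨t, ht⟩ := hb
    have h1 : ∀ s t : A ⊗[k] A, δ.preCanonicalMap s = 1 ⊗ₜ a →
        ∃ r, δ.preCanonicalMap r = (1 ⊗ₜ a) * δ.preCanonicalMap t := by
      intro s t hs
      induction t with
      | zero => exact ⟨0, by simp⟩
      | add p q hp hq =>
        obtain ⟨x, hx⟩ := hp
        obtain ⟨y, hy⟩ := hq
        exact ⟨x + y, by rw [map_add, map_add, mul_add, hx, hy]⟩
      | tmul c d =>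
        -- The lift s of 1 ⊗ a is inserted between the legs of c ⊗ d. Its image is (c ⊗ 1)(1 ⊗
        -- a)δ(d), and the first two factors commute.
        refine ⟨(c ⊗ₜ 1) * (LinearMap.mulRight k d).lTensor A s, ?_⟩
        have h2 : ∀ s : A ⊗[k] A, δ.preCanonicalMap ((LinearMap.mulRight k d).lTensor A s) =
            δ.preCanonicalMap s * δ.coact d := by
          intro s
          induction s with
          | zero => simp
          | add p q hp hq => simp only [map_add, add_mul, hp, hq]
          | tmul x y => simp [preCanonicalMap_tmul, mul_assoc]
        rw [preCanonicalMap_tmul_one_mul, h2, hs, preCanonicalMap_tmul, ← mul_assoc, ← mul_assoc]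
        simp
    obtain ⟨r, hr⟩ := h1 s t hs
    exact ⟨r, by rw [hr, ht]; simp⟩

theorem mem_canonicalSubalgebra {g : H} : g ∈ canonicalSubalgebra δ ↔
    (1 : A) ⊗ₜ[k] g ∈ LinearMap.range δ.preCanonicalMap := Iff.rfl

end RightComoduleAlgebra

end HopfGalois

/-! ### Powers of linear forms -/

/-- Over a field of characteristic zero, a linear functional on polynomials which vanishes
on all powers of linear forms is zero. -/
theorem MvPolynomial.functional_eq_zero_of_pow {k σ : Type*} [Field k] [CharZero k] [Fintype σ]
    (φ : MvPolynomial σ k →ₗ[k] k)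
    (h : ∀ (c : σ → k) (n : ℕ), φ ((∑ i, c i • MvPolynomial.X i) ^ n) = 0) : φ = 0 := by
  classical
  refine (MvPolynomial.basisMonomials σ k).ext fun s => ?_
  let n := ∑ i, s i
  -- P is φ of the n-th power of the linear form, as a polynomial in the coefficients c. It vanishes
  -- at every c, hence is zero because the field is infinite, and its coefficient at s is a nonzero
  -- multinomial coefficient times φ of the monomial s.
  let P : MvPolynomial σ k := ∑ m ∈ Finset.piAntidiag Finset.univ n,
    MvPolynomial.monomial (Finsupp.equivFunOnFinite.symm m)
      ((Nat.multinomial Finset.univ m : k) * φ (∏ i, MvPolynomial.X i ^ m i))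
  have hP : P = 0 := by
    refine MvPolynomial.funext fun c => ?_
    rw [map_zero, ← h c n, Finset.sum_pow_eq_sum_piAntidiag]
    simp only [P, map_sum, MvPolynomial.eval_monomial]
    refine Finset.sum_congr rfl fun m _ => ?_
    have h1 : (Nat.multinomial Finset.univ m : MvPolynomial σ k) *
        ∏ i, (c i • MvPolynomial.X i : MvPolynomial σ k) ^ m i =
        ((Nat.multinomial Finset.univ m : k) * ∏ i, c i ^ m i) • ∏ i, MvPolynomial.X i ^ m i := by
      simp only [MvPolynomial.smul_eq_C_mul, mul_pow, Finset.prod_mul_distrib, map_mul, map_prod,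
        map_pow, map_natCast, mul_assoc]
    rw [h1, map_smul, smul_eq_mul, Finsupp.prod_fintype _ _ (by simp)]
    simp only [Finsupp.equivFunOnFinite_symm_apply_apply]
    ring
  have hs := congrArg (MvPolynomial.coeff s) hP
  have h2 : ∀ m : σ → ℕ, Finsupp.equivFunOnFinite.symm m = s ↔ m = s :=
    fun m => ⟨fun h => by rw [← h]; rfl, fun h => by subst h; ext; rfl⟩
  simp only [P, MvPolynomial.coeff_sum, MvPolynomial.coeff_monomial, h2, Finset.sum_ite_eq',
    MvPolynomial.coeff_zero] at hs
  rw [if_pos (by simp [n])] at hs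
  have h3 : (Nat.multinomial Finset.univ s : k) ≠ 0 :=
    Nat.cast_ne_zero.2 (Nat.multinomial_pos _ _).ne'
  change φ (MvPolynomial.monomial s 1) = 0
  rw [MvPolynomial.monomial_eq, map_one, one_mul,
    Finsupp.prod_fintype _ _ (by simp)]
  exact (mul_eq_zero.1 hs).resolve_left h3

/-- Over a field of characteristic zero, the powers of linear forms span the polynomials. -/
theorem MvPolynomial.span_pow_linear {k σ : Type*} [Field k] [CharZero k] [Fintype σ] :
    Submodule.span k (Set.range fun p : (σ → k) × ℕ =>
      (∑ i, p.1 i • (MvPolynomial.X i : MvPolynomial σ k)) ^ p.2) = ⊤ := by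
  by_contra hne
  obtain ⟨φ, hφ, hle⟩ := Submodule.exists_le_ker_of_lt_top _ (lt_top_iff_ne_top.2 hne)
  exact hφ (MvPolynomial.functional_eq_zero_of_pow φ fun c n =>
    hle (Submodule.subset_span ⟨(c, n), rfl⟩))

/-! ### Sums over antidiagonals -/

open Finset.HasAntidiagonal (antidiagonal mem_antidiagonal)

theorem sum_antidiagonal_diag {M : Type*} [AddCommMonoid M] (n : ℕ) (F : ℕ → M) :
    ∑ x ∈ antidiagonal n, (if x.1 = x.2 then F x.1 else 0) =
      if Even n then F (n / 2) else 0 := by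
  split_ifs with hn
  · obtain ⟨m, rfl⟩ := hn
    rw [Finset.sum_eq_single (m, m)]
    · simp [← two_mul]
    · rintro ⟨i, j⟩ hij hne
      rw [mem_antidiagonal] at hij
      refine if_neg fun h => hne ?_
      simp only at hij h
      ext <;> simp only <;> omega
    · intro h
      exact (h (mem_antidiagonal.2 rfl)).elim
  · refine Finset.sum_eq_zero fun x hx => if_neg fun h => hn ?_
    rw [mem_antidiagonal] at hx
    exact ⟨x.1, by omega⟩

theorem sum_antidiagonal_even {M : Type*} [AddCommMonoid M] (n : ℕ) (G : ℕ → ℕ → M) :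
    ∑ x ∈ antidiagonal n, (if Even x.1 then if Even x.2 then G (x.1 / 2) (x.2 / 2) else 0
      else 0) =
      if Even n then ∑ y ∈ antidiagonal (n / 2), G y.1 y.2 else 0 := by
  split_ifs with hn
  · obtain ⟨m, rfl⟩ := hn
    rw [← two_mul, Nat.mul_div_cancel_left _ two_pos]
    symm
    refine Finset.sum_of_injOn (fun y : ℕ × ℕ => (2 * y.1, 2 * y.2)) ?_ ?_ ?_ ?_
    · rintro ⟨i, j⟩ _ ⟨i', j'⟩ _ h
      simpa using h
    · rintro ⟨i, j⟩ h
      simp only [SetLike.mem_coe, mem_antidiagonal] at h ⊢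
      omega
    · rintro ⟨i, j⟩ h h'
      rw [mem_antidiagonal] at h
      simp only at h
      refine ite_eq_right_iff.2 fun hi => ite_eq_right_iff.2 fun hj => absurd ?_ h'
      obtain ⟨i, rfl⟩ := hi
      obtain ⟨j, rfl⟩ := hj
      refine ⟨(i, j), ?_, ?_⟩
      · simp only [Finset.mem_coe, mem_antidiagonal]
        omega
      · simp [two_mul]
    · rintro ⟨i, j⟩ _
      simp
  · refine Finset.sum_eq_zero fun x hx => ?_
    rw [mem_antidiagonal] at hx
    refine ite_eq_right_iff.2 fun hi => ite_eq_right_iff.2 fun hj => absurd ?_ hn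
    rw [← hx]
    exact hi.add hj

/-- The divided power `xⁿ / n!`. -/
def dividedPow {S : Type*} [CommRing S] [Algebra ℂ S] (x : S) (n : ℕ) : S :=
  ((n.factorial : ℂ)⁻¹) • x ^ n

/-- Dividing by factorials removes the binomial coefficients, so that powers of sums are plain
convolutions. -/
theorem dividedPow_add {S : Type*} [CommRing S] [Algebra ℂ S] (x y : S) (n : ℕ) :
    dividedPow (x + y) n =
      ∑ p ∈ antidiagonal n, dividedPow x p.1 * dividedPow y p.2 := by
  rw [dividedPow, (Commute.all x y).add_pow', Finset.smul_sum]
  refine Finset.sum_congr rfl fun p hp => ?_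
  rw [mem_antidiagonal] at hp
  subst hp
  rw [dividedPow, dividedPow, smul_mul_smul_comm, ← Nat.cast_smul_eq_nsmul ℂ, smul_smul]
  congr 1
  have h := Nat.add_choose_mul_factorial_mul_factorial p.1 p.2
  have h1 : ((p.1.factorial : ℂ)) ≠ 0 := Nat.cast_ne_zero.2 (Nat.factorial_ne_zero _)
  have h2 : ((p.2.factorial : ℂ)) ≠ 0 := Nat.cast_ne_zero.2 (Nat.factorial_ne_zero _)
  have h3 : (((p.1 + p.2).factorial : ℂ)) ≠ 0 := Nat.cast_ne_zero.2 (Nat.factorial_ne_zero _)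
  have h' : (((p.1 + p.2).choose p.1 : ℂ)) * p.1.factorial * p.2.factorial =
      (p.1 + p.2).factorial := by
    rw [Nat.choose_symm_add]
    exact_mod_cast h
  field_simp
  rw [← h']

namespace InstantonBundle

open HopfGalois OOddSphere

/-! ### The invariant integral on `𝒪(SU(2))` -/

/-- The integral of `w₁ⁱ w₁*ʲ w₂ᵏ w₂*ˡ` over `SU(2)`. -/
def haarWeight (i j k l : ℕ) : ℂ :=
  if i = j ∧ k = l then (i.factorial * k.factorial : ℂ) / ((i + k + 1).factorial : ℂ) else 0

/-- The integral of a polynomial in `w₁, w₂, w₁*, w₂*` over `SU(2)`. -/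
def haarPoly : MvPolynomial (Fin 2 ⊕ Fin 2) ℂ →ₗ[ℂ] ℂ :=
  (MvPolynomial.basisMonomials (Fin 2 ⊕ Fin 2) ℂ).constr ℂ fun s =>
    haarWeight (s (Sum.inl 0)) (s (Sum.inr 0)) (s (Sum.inl 1)) (s (Sum.inr 1))

theorem monomial_eq_prod (s : Fin 2 ⊕ Fin 2 →₀ ℕ) :
    MvPolynomial.monomial s (1 : ℂ) =
      MvPolynomial.X (Sum.inl 0) ^ s (Sum.inl 0) * MvPolynomial.X (Sum.inr 0) ^ s (Sum.inr 0) *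
        (MvPolynomial.X (Sum.inl 1) ^ s (Sum.inl 1) *
          MvPolynomial.X (Sum.inr 1) ^ s (Sum.inr 1)) := by
  rw [MvPolynomial.monomial_eq, map_one, one_mul, Finsupp.prod_fintype _ _ (by simp),
    Fintype.prod_sum_type, Fin.prod_univ_two, Fin.prod_univ_two]
  ring

theorem haarPoly_prod (i j k l : ℕ) :
    haarPoly (MvPolynomial.X (Sum.inl 0) ^ i * MvPolynomial.X (Sum.inr 0) ^ j *
      (MvPolynomial.X (Sum.inl 1) ^ k * MvPolynomial.X (Sum.inr 1) ^ l)) =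
        haarWeight i j k l := by
  have h := monomial_eq_prod (Finsupp.equivFunOnFinite.symm (Sum.elim ![i, k] ![j, l]))
  simp only [Finsupp.equivFunOnFinite_symm_apply_apply, Sum.elim_inl, Sum.elim_inr,
    Matrix.cons_val_zero, Matrix.cons_val_one] at h
  have h' : ∀ s, MvPolynomial.monomial s (1 : ℂ) =
      MvPolynomial.basisMonomials (Fin 2 ⊕ Fin 2) ℂ s :=
    fun _ => rfl
  rw [← h, h', haarPoly, Module.Basis.constr_basis]
  simp

/-- In the balanced case this is (i + 1) + (k + 1) = i + k + 2 after clearing factorials. It lets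
the functional on polynomials descend to the quotient by the sphere relation. -/
theorem haarWeight_relation (i j k l : ℕ) :
    haarWeight (i + 1) (j + 1) k l + haarWeight i j (k + 1) (l + 1) = haarWeight i j k l := by
  simp only [haarWeight, add_left_inj]
  split_ifs with h
  · have h1 : ((i + k + 1).factorial : ℂ) ≠ 0 := Nat.cast_ne_zero.2 (Nat.factorial_ne_zero _)
    have h2 : ((i + k + 1 + 1 : ℕ) : ℂ) ≠ 0 := Nat.cast_ne_zero.2 (Nat.succ_ne_zero _)
    rw [show i + 1 + k + 1 = (i + k + 1) + 1 by ring, show i + (k + 1) + 1 = (i + k + 1) + 1 by ring,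
      Nat.factorial_succ (i + k + 1), Nat.factorial_succ i, Nat.factorial_succ k]
    push_cast at h2 ⊢
    field_simp
    ring
  · simp

theorem haarPoly_mul_relation (p : MvPolynomial (Fin 2 ⊕ Fin 2) ℂ) :
    haarPoly (p * oddSphereRelation 2) = 0 := by
  have h1 : ∀ s : Fin 2 ⊕ Fin 2 →₀ ℕ,
      haarPoly (MvPolynomial.monomial s 1 * oddSphereRelation 2) = 0 := by
    intro s
    rw [monomial_eq_prod, oddSphereRelation, Fin.sum_univ_two]
    generalize s (Sum.inl 0) = i
    generalize s (Sum.inr 0) = j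
    generalize s (Sum.inl 1) = k
    generalize s (Sum.inr 1) = l
    have h2 : ∀ a b c d : MvPolynomial (Fin 2 ⊕ Fin 2) ℂ,
        a ^ i * b ^ j * (c ^ k * d ^ l) * (b * a + d * c - 1) =
        a ^ (i + 1) * b ^ (j + 1) * (c ^ k * d ^ l) +
          a ^ i * b ^ j * (c ^ (k + 1) * d ^ (l + 1)) - a ^ i * b ^ j * (c ^ k * d ^ l) := by
      intro a b c d
      ring
    rw [h2, map_sub, map_add, haarPoly_prod, haarPoly_prod, haarPoly_prod, haarWeight_relation,
      sub_self]
  rw [p.as_sum, Finset.sum_mul, map_sum]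
  refine Finset.sum_eq_zero fun s _ => ?_
  have h2 : MvPolynomial.monomial s (p.coeff s) = p.coeff s • MvPolynomial.monomial s (1 : ℂ) := by
    rw [MvPolynomial.smul_monomial, smul_eq_mul, mul_one]
  rw [h2, smul_mul_assoc, map_smul, h1, smul_zero]

theorem mk_surjective {n : ℕ} : Function.Surjective (mk : _ →ₐ[ℂ] OOddSphere n) :=
  Ideal.Quotient.mk_surjective

theorem mk_X_inl {n : ℕ} (i : Fin n) : mk (MvPolynomial.X (Sum.inl i)) = z i := rfl

theorem mk_X_inr {n : ℕ} (i : Fin n) : mk (MvPolynomial.X (Sum.inr i)) = zs i := rfl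

theorem exists_haar : ∃ h : OSU2 →ₗ[ℂ] ℂ, ∀ p, h (mk p) = haarPoly p := by
  obtain ⟨s, hs⟩ := (mk : _ →ₐ[ℂ] OSU2).toLinearMap.exists_rightInverse_of_surjective
    (LinearMap.range_eq_top.2 mk_surjective)
  refine ⟨haarPoly ∘ₗ s, fun p => ?_⟩
  have h1 : mk (s (mk p)) = mk p := LinearMap.congr_fun hs (mk p)
  obtain ⟨q, hq⟩ := Ideal.mem_span_singleton'.1 (Ideal.Quotient.eq.1 h1)
  rw [LinearMap.comp_apply, ← sub_eq_zero, ← map_sub, ← hq, haarPoly_mul_relation]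

/-- The invariant integral on `𝒪(SU(2))`. -/
def haar : OSU2 →ₗ[ℂ] ℂ := exists_haar.choose

theorem haar_mk (p : MvPolynomial (Fin 2 ⊕ Fin 2) ℂ) : haar (mk p) = haarPoly p :=
  exists_haar.choose_spec p

theorem haar_prod (i j k l : ℕ) :
    haar (z 0 ^ i * zs 0 ^ j * (z 1 ^ k * zs 1 ^ l)) = haarWeight i j k l := by
  rw [← haarPoly_prod, ← haar_mk]
  simp only [map_mul, map_pow, mk_X_inl, mk_X_inr]

theorem haar_one : haar 1 = 1 := by
  have h := haar_prod 0 0 0 0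
  simpa [haarWeight] using h

/-- The integral of a divided power of a linear form in `w₁, w₁*, w₂, w₂*`. -/
theorem slice_haar_dividedPow {R : Type*} [CommRing R] [Algebra ℂ R] (a a' c c' : R) (n : ℕ) :
    slice R haar (dividedPow
      ((a ⊗ₜ[ℂ] (z 0 : OSU2) + a' ⊗ₜ zs 0) + (c ⊗ₜ z 1 + c' ⊗ₜ zs 1)) n) =
      if Even n then (((n / 2 + 1).factorial : ℂ)⁻¹) • dividedPow (a * a' + c * c') (n / 2)
      else 0 := by
  -- Only i = j, k = l contribute. The factor i! k! of the integral cancels half of the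
  -- denominators, leaving divided powers of aa' and cc' with a weight depending on i + k only.
  have h1 : ∀ i j k l : ℕ, slice R haar
      ((dividedPow (a ⊗ₜ[ℂ] (z 0 : OSU2)) i * dividedPow (a' ⊗ₜ[ℂ] (zs 0 : OSU2)) j) *
        (dividedPow (c ⊗ₜ[ℂ] (z 1 : OSU2)) k * dividedPow (c' ⊗ₜ[ℂ] (zs 1 : OSU2)) l)) =
      if i = j then if k = l then (((i + k + 1).factorial : ℂ)⁻¹) •
        (dividedPow (a * a') i * dividedPow (c * c') k) else 0 else 0 := by
    intro i j k l
    simp only [dividedPow, Algebra.TensorProduct.tmul_pow, smul_mul_smul_comm,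
      Algebra.TensorProduct.tmul_mul_tmul, map_smul, slice_tmul, haar_prod, haarWeight,
      ← ite_and]
    split_ifs with h
    · obtain ⟨rfl, rfl⟩ := h
      have h1 : ((i.factorial : ℂ)) ≠ 0 := Nat.cast_ne_zero.2 (Nat.factorial_ne_zero _)
      have h2 : ((k.factorial : ℂ)) ≠ 0 := Nat.cast_ne_zero.2 (Nat.factorial_ne_zero _)
      rw [smul_smul, smul_smul, mul_pow, mul_pow]
      congr 1
      field_simp
    · simp
  simp only [dividedPow_add, Finset.sum_mul_sum, map_sum, h1]
  have h2 : ∀ p q : ℕ, (∑ x ∈ antidiagonal p, ∑ y ∈ antidiagonal q,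
      if x.1 = x.2 then if y.1 = y.2 then (((x.1 + y.1 + 1).factorial : ℂ)⁻¹) •
        (dividedPow (a * a') x.1 * dividedPow (c * c') y.1) else 0 else 0) =
      if Even p then if Even q then (((p / 2 + q / 2 + 1).factorial : ℂ)⁻¹) •
        (dividedPow (a * a') (p / 2) * dividedPow (c * c') (q / 2)) else 0 else 0 := by
    intro p q
    rw [← sum_antidiagonal_diag p fun i => if Even q then
      (((i + q / 2 + 1).factorial : ℂ)⁻¹) •
        (dividedPow (a * a') i * dividedPow (c * c') (q / 2)) else 0]
    refine Finset.sum_congr rfl fun x _ => ?_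
    by_cases hx : x.1 = x.2
    · simp only [if_pos hx]
      exact sum_antidiagonal_diag q fun j => (((x.1 + j + 1).factorial : ℂ)⁻¹) •
        (dividedPow (a * a') x.1 * dividedPow (c * c') j)
    · simp only [if_neg hx, Finset.sum_const_zero]
  simp only [h2]
  -- Now i + k = n / 2 is constant on the sum, so the weight factors out and the rest is the divided
  -- power of aa' + cc'.
  rw [sum_antidiagonal_even n fun i k => (((i + k + 1).factorial : ℂ)⁻¹) •
        (dividedPow (a * a') i * dividedPow (c * c') k)]
  refine if_congr Iff.rfl ?_ rfl
  rw [Finset.smul_sum]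
  refine Finset.sum_congr rfl fun y hy => ?_
  rw [mem_antidiagonal.1 hy]

/-- The integral of the `n`-th power of a linear form in `w₁, w₁*, w₂, w₂*` is a multiple of a
power of its determinant, by a number that depends on `n` only. -/
theorem slice_haar_pow {R : Type*} [CommRing R] [Algebra ℂ R] (a a' c c' : R) (n : ℕ) :
    slice R haar (((a ⊗ₜ[ℂ] (z 0 : OSU2) + a' ⊗ₜ zs 0) + (c ⊗ₜ z 1 + c' ⊗ₜ zs 1)) ^ n) =
      (if Even n then (n.factorial : ℂ) * ((n / 2 + 1).factorial : ℂ)⁻¹ *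
        ((n / 2).factorial : ℂ)⁻¹ else 0) • (a * a' + c * c') ^ (n / 2) := by
  have h := slice_haar_dividedPow a a' c c' n
  have h1 : ((n.factorial : ℂ)) ≠ 0 := Nat.cast_ne_zero.2 (Nat.factorial_ne_zero _)
  rw [dividedPow, map_smul, inv_smul_eq_iff₀ h1] at h
  rw [h]
  split_ifs
  · rw [dividedPow, smul_smul, smul_smul]
  · simp

/-- Linear maps on `𝒪(S²ⁿ⁻¹)` which agree on the powers of linear forms are equal. -/
theorem OOddSphere.linearMap_ext_pow {n : ℕ} {M : Type*} [AddCommGroup M] [Module ℂ M]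
    {f g : OOddSphere n →ₗ[ℂ] M}
    (h : ∀ (a b : Fin n → ℂ) (m : ℕ),
      f ((∑ i, a i • z i + ∑ i, b i • zs i) ^ m) = g ((∑ i, a i • z i + ∑ i, b i • zs i) ^ m)) :
    f = g := by
  have h1 : f ∘ₗ mk.toLinearMap = g ∘ₗ mk.toLinearMap := by
    refine LinearMap.ext_on_range (MvPolynomial.span_pow_linear) fun p => ?_
    have := h (fun i => p.1 (Sum.inl i)) (fun i => p.1 (Sum.inr i)) p.2
    simpa [Fintype.sum_sum_type, mk_X_inl, mk_X_inr] using this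
  refine LinearMap.ext fun x => ?_
  obtain ⟨p, rfl⟩ := mk_surjective x
  exact LinearMap.congr_fun h1 p

/-! ### Antipode and invariance for 𝒪(SU(2)) -/

theorem comul_antipode_SU2 (g : OSU2) :
    Coalgebra.comul (R := ℂ) (HopfAlgebra.antipode ℂ g) =
      TensorProduct.comm ℂ OSU2 OSU2 (TensorProduct.map (HopfAlgebra.antipode ℂ)
        (HopfAlgebra.antipode ℂ) (Coalgebra.comul (R := ℂ) g)) := by
  have h : comulSU2.comp antipodeSU2 =
      ((Algebra.TensorProduct.comm ℂ OSU2 OSU2).toAlgHom.comp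
        (Algebra.TensorProduct.map antipodeSU2 antipodeSU2)).comp comulSU2 :=
    algHom_ext_T fun i j => by
      fin_cases i <;> fin_cases j <;>
        simp [comulSU2, antipodeSU2, Fin.sum_univ_two, TensorProduct.neg_tmul,
          TensorProduct.tmul_neg] <;> abel
  exact congrArg (fun f => f g) h

theorem antipode_bijective_SU2 : Function.Bijective (HopfAlgebra.antipode ℂ (A := OSU2)) := by
  have h : antipodeSU2.comp antipodeSU2 = AlgHom.id ℂ OSU2 :=
    algHom_ext_T fun i j => by
      fin_cases i <;> fin_cases j <;> simp [antipodeSU2]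
  have h' : Function.Involutive (HopfAlgebra.antipode ℂ (A := OSU2)) :=
    fun g => congrArg (fun f => f g) h
  exact h'.bijective

/-- The coproduct of a linear form is a linear form in the second factor with coefficients in
𝒪(SU(2)), grouped here in the shape needed by `slice_haar_pow`. -/
theorem comulSU2_linear (a b : Fin 2 → ℂ) :
    comulSU2 (∑ i, a i • z i + ∑ i, b i • zs i) =
      ((a 0 • z 0 + a 1 • z 1) ⊗ₜ z 0 + (b 0 • zs 0 + b 1 • zs 1) ⊗ₜ zs 0) +
        ((a 1 • zs 0 - a 0 • zs 1) ⊗ₜ z 1 + (b 1 • z 0 - b 0 • z 1) ⊗ₜ zs 1) := by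
  have h0 : (z 0 : OSU2) = T 0 0 := by simp [T]
  have h1 : (z 1 : OSU2) = T 1 0 := by simp [T]
  have h2 : (zs 0 : OSU2) = T 1 1 := by simp [T]
  have h3 : (zs 1 : OSU2) = -T 0 1 := by simp [T]
  simp only [Fin.sum_univ_two, h0, h1, h2, h3, map_add, map_smul, map_neg]
  simp only [comulSU2, liftT_T, Matrix.of_apply, Fin.sum_univ_two, TensorProduct.add_tmul,
    TensorProduct.sub_tmul, TensorProduct.tmul_neg, TensorProduct.neg_tmul, smul_add, smul_neg,
    TensorProduct.smul_tmul', neg_add]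
  abel

theorem haar_linear_pow (a b : Fin 2 → ℂ) (n : ℕ) :
    haar ((∑ i, a i • z i + ∑ i, b i • zs i) ^ n) =
      (if Even n then (n.factorial : ℂ) * ((n / 2 + 1).factorial : ℂ)⁻¹ *
        ((n / 2).factorial : ℂ)⁻¹ else 0) • (a 0 * b 0 + a 1 * b 1) ^ (n / 2) := by
  rw [← slice_haar_pow]
  have h : ∀ x : OSU2, slice ℂ haar (Algebra.TensorProduct.includeRight x) = haar x := by
    intro x
    simp
  rw [← h, map_pow]
  congr 2
  simp only [Fin.sum_univ_two, map_add, map_smul, Algebra.TensorProduct.includeRight_apply]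
  simp only [TensorProduct.smul_tmul', smul_eq_mul, mul_one]
  abel

/-- Invariance is tested on powers of linear forms. Both sides carry the same constant, so it
remains to compare quadratic forms: that of the coproduct is a₀b₀ + a₁b₁ times w₁*w₁ + w₂*w₂ = 1. -/
theorem integral_haar : Integral haar where
  map_one := haar_one
  invariant := by
    have h : slice OSU2 haar ∘ₗ comulSU2.toLinearMap =
        (LinearMap.id.smulRight (1 : OSU2)) ∘ₗ haar := by
      refine OOddSphere.linearMap_ext_pow fun a b n => ?_
      simp only [LinearMap.comp_apply, AlgHom.toLinearMap_apply, map_pow, comulSU2_linear,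
        slice_haar_pow, LinearMap.smulRight_apply, LinearMap.id_apply, haar_linear_pow,
        smul_assoc]
      congr 1
      rw [← Algebra.algebraMap_eq_smul_one, map_pow]
      congr 1
      have hs := sum_zs_mul_z (n := 2)
      rw [Fin.sum_univ_two] at hs
      simp only [Algebra.smul_def, map_add, map_mul]
      linear_combination (algebraMap ℂ OSU2 (a 0) * algebraMap ℂ OSU2 (b 0) +
        algebraMap ℂ OSU2 (a 1) * algebraMap ℂ OSU2 (b 1)) * hs
    exact fun g => LinearMap.congr_fun h g
  comul_antipode := comul_antipode_SU2

end InstantonBundle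

namespace HopfGalois

/-! ### Functoriality of twisting -/

section TwistMap

variable {k K A A' : Type*} [Field k] [Ring K] [HopfAlgebra k K] [Ring A] [Algebra k A]
  [Ring A'] [Algebra k A'] {ρ : LeftComoduleAlgebra k K A} {ρ' : LeftComoduleAlgebra k K A'}

theorem twistedMul_map (f : A →ₐ[k] A')
    (hf : ∀ a, ρ'.coact (f a) = f.toLinearMap.lTensor K (ρ.coact a)) (σ : TwoCocycle k K)
    (a b : A) : twistedMul ρ' σ (f a) (f b) = f (twistedMul ρ σ a b) := by
  rw [twistedMul_apply, twistedMul_apply, hf, hf]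
  generalize ρ.coact a = p
  generalize ρ.coact b = q
  induction p with
  | zero => simp
  | add p p' hp hp' => simp only [TensorProduct.add_tmul, map_add, hp, hp']
  | tmul g x =>
    induction q with
    | zero => simp
    | add q q' hq hq' => simp only [TensorProduct.tmul_add, map_add, hq, hq']
    | tmul h y => simp [scaledMul_tmul]

/-- A morphism of left comodule algebras is a morphism of the twisted algebras. -/
def Twisted.map (f : A →ₐ[k] A')
    (hf : ∀ a, ρ'.coact (f a) = f.toLinearMap.lTensor K (ρ.coact a)) (σ : TwoCocycle k K) :
    Twisted ρ σ →ₐ[k] Twisted ρ' σ :=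
  AlgHom.ofLinearMap
    ((Twisted.of ρ' σ).toLinearMap ∘ₗ f.toLinearMap ∘ₗ (Twisted.of ρ σ).symm.toLinearMap)
    (congrArg (Twisted.of ρ' σ) (map_one f))
    (fun a b => (congrArg (Twisted.of ρ' σ) (twistedMul_map f hf σ a b)).symm)

/-- The coinvariants of the twist of a bicomodule algebra are those of the algebra. -/
theorem of_mem_coinvariants_twist {H : Type*} [Ring H] [HopfAlgebra k H]
    (δ : RightComoduleAlgebra k H A) (h : CoactionsCommute ρ δ) (σ : TwoCocycle k K) (a : A) :
    Twisted.of ρ σ a ∈ (δ.twist ρ h σ).coinvariants ↔ a ∈ δ.coinvariants := by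
  rw [RightComoduleAlgebra.mem_coinvariants, RightComoduleAlgebra.mem_coinvariants]
  change (Twisted.of ρ σ).toLinearMap.rTensor H (δ.coact a) =
    (Twisted.of ρ σ).toLinearMap.rTensor H (a ⊗ₜ 1) ↔ _
  exact ((Twisted.of ρ σ).rTensor H).injective.eq_iff

end TwistMap

end HopfGalois

namespace InstantonBundle

open HopfGalois OOddSphere

/-! ### Surjectivity of the canonical map -/

theorem OOddSphere.subalgebra_eq_top {n : ℕ} (S : Subalgebra ℂ (OOddSphere n))
    (h : ∀ i, z i ∈ S) (h' : ∀ i, zs i ∈ S) (x : OOddSphere n) : x ∈ S := by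
  obtain ⟨p, rfl⟩ := mk_surjective x
  induction p using MvPolynomial.induction_on with
  | C a => exact S.algebraMap_mem a
  | add p q hp hq =>
    rw [map_add]
    exact add_mem hp hq
  | mul_X p i hp =>
    rw [map_mul]
    refine mul_mem hp ?_
    rcases i with i | i
    · exact h i
    · exact h' i

theorem OS7Theta.of_mul_of (θ : ℝ) {a b : OS7} {m n : Fin 2 → ℤ}
    (ha : leftS7.coact a = tpow m ⊗ₜ a) (hb : leftS7.coact b = tpow n ⊗ₜ b) :
    (Twisted.of leftS7 (sigma θ) a * Twisted.of leftS7 (sigma θ) b : OS7Theta θ) =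
      bichar θ m n • Twisted.of leftS7 (sigma θ) (a * b) := by
  rw [Twisted.of_mul_of, twistedMul_apply, ha, hb, scaledMul_tmul, map_smul]
  congr 1
  exact sigmaLin_tpow θ m n

theorem leftS7_z (i : Fin 4) : leftS7.coact (z i) = tpow (weight i) ⊗ₜ z i := by
  change coactTorusS7 _ = _
  simp [coactTorusS7]

theorem leftS7_zs (i : Fin 4) : leftS7.coact (zs i) = tpow (-weight i) ⊗ₜ zs i := by
  change coactTorusS7 _ = _
  simp [coactTorusS7]

/-- The left inverse of the matrix `u`. -/
def uInv : Matrix (Fin 2) (Fin 4) OS7 :=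
  !![zs 0, zs 1, zs 2, zs 3; -z 1, z 0, -z 3, z 2]

theorem uInv_mul_u (i j : Fin 2) : ∑ k, uInv i k * u k j = if i = j then 1 else 0 := by
  have h := sum_zs_mul_z (n := 4)
  rw [Fin.sum_univ_four] at h ⊢
  fin_cases i <;> fin_cases j <;> simp [uInv, u]
  · exact h
  · ring
  · ring
  · linear_combination h

/-- The weights of τ come in inverse pairs, so both entries of a row of u have the same degree. -/
theorem leftS7_u (k : Fin 4) (j : Fin 2) : leftS7.coact (u k j) = tpow (weight k) ⊗ₜ u k j := by
  fin_cases k <;> fin_cases j <;>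
    simp [u, leftS7_z, leftS7_zs, weight, TensorProduct.tmul_neg]

theorem leftS7_uInv (i : Fin 2) (k : Fin 4) :
    leftS7.coact (uInv i k) = tpow (-weight k) ⊗ₜ uInv i k := by
  fin_cases i <;> fin_cases k <;>
    simp [uInv, leftS7_z, leftS7_zs, weight, TensorProduct.tmul_neg]

/-- An antisymmetric form vanishes on proportional vectors. Hence the products in `uInv_mul_u` are
not deformed. -/
theorem bichar_neg_weight (θ : ℝ) (k : Fin 4) : bichar θ (-weight k) (weight k) = 1 := by
  fin_cases k <;> simp [bichar, weight, e, Theta, Fin.sum_univ_two]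

/-- Since δ(u) = u ⊗̇ T, the element ∑ₖ (u⁻¹)ᵢₖ ⊗ uₖⱼ is sent to ∑ₗ (u⁻¹u)ᵢₗ ⊗ Tˡⱼ = 1 ⊗ Tⁱⱼ, also
for the deformed product. -/
theorem T_mem_canonicalSubalgebra (θ : ℝ) (i j : Fin 2) :
    T i j ∈ (rightS7Theta θ).canonicalSubalgebra := by
  rw [RightComoduleAlgebra.mem_canonicalSubalgebra]
  refine ⟨∑ k, Twisted.of leftS7 (sigma θ) (uInv i k) ⊗ₜ Twisted.of leftS7 (sigma θ) (u k j), ?_⟩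
  have h1 : ∀ k, (rightS7Theta θ).coact (Twisted.of leftS7 (sigma θ) (u k j)) =
      ∑ l, Twisted.of leftS7 (sigma θ) (u k l) ⊗ₜ T l j := by
    intro k
    refine (twistCoact_of leftS7 rightS7 coactionsCommute_S7 (sigma θ) (u k j)).trans ?_
    change (Twisted.of leftS7 (sigma θ)).toLinearMap.rTensor OSU2 (coactSU2 (u k j)) = _
    rw [coactSU2_u, map_sum]
    rfl
  simp only [map_sum, RightComoduleAlgebra.preCanonicalMap_tmul, h1, Finset.mul_sum,
    Algebra.TensorProduct.tmul_mul_tmul, one_mul,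
    OS7Theta.of_mul_of θ (leftS7_uInv i _) (leftS7_u _ _), bichar_neg_weight, one_smul]
  rw [Finset.sum_comm]
  simp only [← TensorProduct.sum_tmul, ← map_sum, uInv_mul_u]
  rw [Finset.sum_eq_single i]
  · rw [if_pos rfl]
    rfl
  · intro l _ hl
    rw [if_neg hl.symm, map_zero, TensorProduct.zero_tmul]
  · simp

theorem isPrincipal_rightS7Theta (θ : ℝ) : (rightS7Theta θ).IsPrincipal := by
  refine (rightS7Theta θ).isPrincipal_of_integral integral_haar antipode_bijective_SU2
    (OOddSphere.subalgebra_eq_top (rightS7Theta θ).canonicalSubalgebra ?_ ?_)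
  · intro i
    fin_cases i
    · simpa [T] using T_mem_canonicalSubalgebra θ 0 0
    · simpa [T] using T_mem_canonicalSubalgebra θ 1 0
  · intro i
    fin_cases i
    · simpa [T] using T_mem_canonicalSubalgebra θ 1 1
    · simpa [T] using T_mem_canonicalSubalgebra θ 0 1

/-! ### The coinvariants -/

theorem baseInclusion_gen (i : S4Gen) : baseInclusion (OS4.gen i) = baseGen i := by
  simp [baseInclusion]

/-- The `2 × 2` minor of the matrix `u` on the rows `i, j`. -/
def minor (i j : Fin 4) : OS7 := u i 0 * u j 1 - u j 0 * u i 1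

theorem baseGen_eq_minor (i : S4Gen) : baseGen i = match i with
    | .alpha => 2 * minor 0 3
    | .alphaStar => -2 * minor 1 2
    | .beta => 2 * minor 1 3
    | .betaStar => 2 * minor 0 2
    | .x => minor 0 1 - minor 2 3 := by
  cases i <;> simp [baseGen, minor, u] <;> ring

/-- Up to sign, four of the six minors are halves of α, α*, β, β*. The other two have difference x
and, by the sphere relation, sum 1, so they are (1 ± x)/2. -/
theorem minor_mem_range (i j : Fin 4) : minor i j ∈ baseInclusion.range := by
  have hs := sum_zs_mul_z (n := 4)
  rw [Fin.sum_univ_four] at hs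
  have half : ∀ (y : OS4) (m : OS7), baseInclusion y = 2 * m → m ∈ baseInclusion.range := by
    intro y m h
    refine ⟨(1 / 2 : ℂ) • y, ?_⟩
    have h2 : (2 : OS7) = algebraMap ℂ OS7 2 := (map_ofNat _ 2).symm
    change baseInclusion ((1 / 2 : ℂ) • y) = m
    rw [map_smul, h, h2, ← Algebra.smul_def, smul_smul]
    norm_num
  have h01 : minor 0 1 ∈ baseInclusion.range := half (1 + OS4.gen .x) _ <| by
    rw [map_add, map_one, baseInclusion_gen]
    simp [baseGen, minor, u]
    linear_combination -hs
  have h23 : minor 2 3 ∈ baseInclusion.range := half (1 - OS4.gen .x) _ <| by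
    rw [map_sub, map_one, baseInclusion_gen]
    simp [baseGen, minor, u]
    linear_combination -hs
  have h02 : minor 0 2 ∈ baseInclusion.range := half (OS4.gen .betaStar) _ <| by
    rw [baseInclusion_gen, baseGen_eq_minor]
  have h03 : minor 0 3 ∈ baseInclusion.range := half (OS4.gen .alpha) _ <| by
    rw [baseInclusion_gen, baseGen_eq_minor]
  have h12 : minor 1 2 ∈ baseInclusion.range := half (-OS4.gen .alphaStar) _ <| by
    rw [map_neg, baseInclusion_gen, baseGen_eq_minor]
    ring
  have h13 : minor 1 3 ∈ baseInclusion.range := half (OS4.gen .beta) _ <| by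
    rw [baseInclusion_gen, baseGen_eq_minor]
  have hsymm : ∀ i j, minor i j = -minor j i := by
    intro i j
    simp only [minor]
    ring
  have hself : ∀ i, minor i i = 0 := fun i => sub_self _
  have hneg : ∀ i j, minor i j ∈ baseInclusion.range → minor j i ∈ baseInclusion.range := by
    intro i j h
    rw [hsymm]
    exact neg_mem h
  match i, j with
  | 0, 0 => exact by rw [hself]; exact zero_mem _
  | 0, 1 => exact h01
  | 0, 2 => exact h02
  | 0, 3 => exact h03
  | 1, 0 => exact hneg _ _ h01
  | 1, 1 => exact by rw [hself]; exact zero_mem _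
  | 1, 2 => exact h12
  | 1, 3 => exact h13
  | 2, 0 => exact hneg _ _ h02
  | 2, 1 => exact hneg _ _ h12
  | 2, 2 => exact by rw [hself]; exact zero_mem _
  | 2, 3 => exact h23
  | 3, 0 => exact hneg _ _ h03
  | 3, 1 => exact hneg _ _ h13
  | 3, 2 => exact hneg _ _ h23
  | 3, 3 => exact by rw [hself]; exact zero_mem _

theorem coactSU2_linear (a b : Fin 4 → ℂ) :
    ∃ p p' q q' : OS7, coactSU2 (∑ i, a i • z i + ∑ i, b i • zs i) =
      ((p ⊗ₜ z 0 + p' ⊗ₜ zs 0) + (q ⊗ₜ z 1 + q' ⊗ₜ zs 1)) ∧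
        p * p' + q * q' ∈ baseInclusion.range := by
  -- These are the coefficients of ∑ bᵢ zᵢ* in terms of the second column (-z₂*, z₁*, -z₄*, z₃*) of
  -- u. The quadratic form of the coacted linear form then becomes ∑ aᵢ mⱼ times the (i, j) minor.
  let m : Fin 4 → ℂ := ![-b 1, b 0, -b 3, b 2]
  refine ⟨∑ i, a i • u i 0, ∑ i, m i • u i 1, ∑ i, a i • u i 1, -∑ i, m i • u i 0, ?_, ?_⟩
  · have h1 : ∑ i, a i • z i + ∑ i, b i • zs i = ∑ i, a i • u i 0 + ∑ i, m i • u i 1 := by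
      simp [Fin.sum_univ_four, u, m]
      abel
    have h0 : ∀ k, coactSU2 (u k 0) = u k 0 ⊗ₜ z 0 + u k 1 ⊗ₜ z 1 := by
      intro k
      rw [coactSU2_u, Fin.sum_univ_two]
      simp [T]
    have h0' : ∀ k, coactSU2 (u k 1) = -(u k 0 ⊗ₜ zs 1) + u k 1 ⊗ₜ zs 0 := by
      intro k
      rw [coactSU2_u, Fin.sum_univ_two]
      simp [T, TensorProduct.tmul_neg]
    rw [h1]
    simp only [map_add, map_sum, map_smul, h0, h0', TensorProduct.neg_tmul,
      TensorProduct.sum_tmul, ← TensorProduct.smul_tmul', smul_add, smul_neg,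
      Finset.sum_add_distrib, Finset.sum_neg_distrib]
    abel
  · have h2 : (∑ i, a i • u i 0) * (∑ i, m i • u i 1) + (∑ i, a i • u i 1) * -(∑ i, m i • u i 0) =
        ∑ i, ∑ j, (a i * m j) • minor i j := by
      rw [mul_neg, ← sub_eq_add_neg, Finset.sum_mul_sum, Finset.sum_mul_sum,
        ← Finset.sum_sub_distrib]
      refine Finset.sum_congr rfl fun i _ => ?_
      rw [← Finset.sum_sub_distrib]
      refine Finset.sum_congr rfl fun j _ => ?_
      rw [smul_mul_smul_comm, smul_mul_smul_comm, ← smul_sub, minor, mul_comm (u i 1)]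
    rw [h2]
    exact sum_mem fun i _ => sum_mem fun j _ => Subalgebra.smul_mem _ (minor_mem_range i j) _

theorem slice_coactSU2_mem (x : OS7) : slice OS7 haar (coactSU2 x) ∈ baseInclusion.range := by
  have h : (Subalgebra.toSubmodule baseInclusion.range).mkQ ∘ₗ slice OS7 haar ∘ₗ
      coactSU2.toLinearMap = 0 := by
    refine OOddSphere.linearMap_ext_pow fun a b n => ?_
    obtain ⟨p, p', q, q', h1, h2⟩ := coactSU2_linear a b
    rw [LinearMap.comp_apply, LinearMap.comp_apply, AlgHom.toLinearMap_apply, map_pow, h1,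
      slice_haar_pow, LinearMap.zero_apply, Submodule.mkQ_apply, Submodule.Quotient.mk_eq_zero]
    exact Subalgebra.smul_mem _ (pow_mem h2 _) _
  have hx := LinearMap.congr_fun h x
  rwa [LinearMap.comp_apply, LinearMap.zero_apply, Submodule.mkQ_apply,
    Submodule.Quotient.mk_eq_zero] at hx

theorem coactSU2_minor (i j : Fin 4) : coactSU2 (minor i j) = minor i j ⊗ₜ 1 := by
  have hR := congrArg (Algebra.TensorProduct.includeRight : OSU2 →ₐ[ℂ] OS7 ⊗[ℂ] OSU2) det_T
  have hm : ∀ (a : OS7) (b : OSU2), a ⊗ₜ[ℂ] b =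
      (Algebra.TensorProduct.includeLeft : OS7 →ₐ[ℂ] OS7 ⊗[ℂ] OSU2) a *
        (Algebra.TensorProduct.includeRight : OSU2 →ₐ[ℂ] OS7 ⊗[ℂ] OSU2) b := by
    intro a b
    simp
  simp only [minor, map_sub, map_mul, map_one, coactSU2_u, Fin.sum_univ_two, hm] at hR ⊢
  generalize (Algebra.TensorProduct.includeLeft : OS7 →ₐ[ℂ] OS7 ⊗[ℂ] OSU2) = L at *
  generalize (Algebra.TensorProduct.includeRight : OSU2 →ₐ[ℂ] OS7 ⊗[ℂ] OSU2) = R at *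
  linear_combination (L (u i 0) * L (u j 1) - L (u j 0) * L (u i 1)) * hR

/-- Minors are invariant because det T = 1. Conversely a coinvariant equals its own average over
SU(2), and all averages lie in the range by `slice_coactSU2_mem`. -/
theorem range_baseInclusion : baseInclusion.range = rightS7.coinvariants := by
  refine le_antisymm ?_ fun a ha => ?_
  · rintro _ ⟨b, rfl⟩
    have h : coactSU2.comp baseInclusion =
        (Algebra.TensorProduct.includeLeft : OS7 →ₐ[ℂ] OS7 ⊗[ℂ] OSU2).comp baseInclusion := by
      refine OS4.algHom_ext fun i => ?_
      have h2 : ∀ x : OS7 ⊗[ℂ] OSU2, 2 * x = (2 : ℂ) • x := fun x => by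
        rw [Algebra.smul_def, map_ofNat]
      have h2' : ∀ x : OS7, 2 * x = (2 : ℂ) • x := fun x => by
        rw [Algebra.smul_def, map_ofNat]
      simp only [AlgHom.comp_apply, baseInclusion_gen, baseGen_eq_minor]
      cases i <;> simp only [neg_mul, h2', map_neg, map_smul, map_sub, coactSU2_minor,
        Algebra.TensorProduct.includeLeft_apply]
    exact congrArg (fun f => f b) h
  · have h := slice_coactSU2_mem a
    have h' : coactSU2 a = a ⊗ₜ 1 := ha
    rwa [h', slice_tmul, haar_one, one_smul] at h

/-! ### Injectivity of `𝒪(S⁴) → 𝒪(S⁷)` -/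

theorem OS4.alpha_mem_nonZeroDivisors : OS4.gen .alpha ∈ nonZeroDivisors OS4 := by
  rw [mem_nonZeroDivisors_iff_right]
  intro y hy
  obtain ⟨p, rfl⟩ : ∃ p, OS4.mk p = y := Ideal.Quotient.mk_surjective y
  have h1 : OS4.mk (p * MvPolynomial.X .alpha) = 0 := by rw [map_mul]; exact hy
  obtain ⟨q, hq⟩ := Ideal.mem_span_singleton'.1 (Ideal.Quotient.eq_zero_iff_mem.1 h1)
  have hX : Prime (MvPolynomial.X .alpha : MvPolynomial S4Gen ℂ) := MvPolynomial.X_prime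
  have hdvd : (MvPolynomial.X .alpha : MvPolynomial S4Gen ℂ) ∣ q * relationS4 :=
    ⟨p, by rw [hq, mul_comm]⟩
  rcases hX.dvd_or_dvd hdvd with ⟨r, rfl⟩ | ⟨r, hr⟩
  · have hp : p = r * relationS4 := by
      refine mul_right_cancel₀ hX.ne_zero ?_
      rw [← hq]
      ring
    rw [hp, map_mul, OS4.mk_relation, mul_zero]
  -- The relation has constant term -1, so the prime α does not divide it.
  · have := congrArg (MvPolynomial.eval 0) hr
    simp [relationS4] at this

/-- The bundle has an algebraic section where α is invertible, so ι followed by a suitable morphism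
r is the localization map, which is injective. -/
theorem baseInclusion_injective : Function.Injective baseInclusion := by
  let L := Localization.Away (OS4.gen .alpha)
  let a : OS4 →ₐ[ℂ] L := IsScalarTower.toAlgHom ℂ OS4 L
  let w : L := IsLocalization.Away.invSelf (OS4.gen .alpha)
  have hw : a (OS4.gen .alpha) * w = 1 := IsLocalization.Away.mul_invSelf (OS4.gen .alpha)
  have ha : Function.Injective a := IsLocalization.injective L
    (Submonoid.powers_le.2 OS4.alpha_mem_nonZeroDivisors)
  let c : L := algebraMap ℂ L (1 / 2)
  have hc : 2 * c = 1 := by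
    have : (2 : L) = algebraMap ℂ L 2 := (map_ofNat _ 2).symm
    rw [this, ← map_mul]
    norm_num
  have hrel := congrArg a OS4.relation
  simp only [map_add, map_mul, map_pow, map_one] at hrel
  -- Rows 1 and 4 of u have minor α/2, so a change by SL(2) brings them to (α/2, 0) and (0, 1). The
  -- remaining minors then determine the other two rows. The morphism need not respect the star
  -- structure, as zᵢ and zᵢ* are independent generators.
  let r : OS7 →ₐ[ℂ] L := lift
    ![c * a (OS4.gen .alpha), c * a (OS4.gen .beta), c * (1 - a (OS4.gen .x)), 0]
    ![(1 + a (OS4.gen .x)) * w, 0, 1, -(a (OS4.gen .betaStar) * w)] <| by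
      simp only [Fin.sum_univ_four, Matrix.cons_val]
      linear_combination (c * (1 + a (OS4.gen .x))) * hw + hc
  have hr : r.comp baseInclusion = a := by
    refine OS4.algHom_ext fun i => ?_
    have h2 : ∀ f : OS7 →ₐ[ℂ] L, f 2 = 2 := fun f => map_ofNat f 2
    rw [AlgHom.comp_apply, baseInclusion_gen]
    cases i <;>
      simp only [baseGen, map_mul, map_add, map_sub, h2, r, lift_z, lift_zs, Matrix.cons_val]
    · linear_combination a (OS4.gen .alpha) * hc
    -- Only α* uses the relation of the four-sphere: r sends its image to (1 - x² - ββ*)/α.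
    · linear_combination (-2 * c * w) * hrel + 2 * c * a (OS4.gen .alphaStar) * hw +
        a (OS4.gen .alphaStar) * hc
    · linear_combination a (OS4.gen .beta) * hc
    · linear_combination 2 * c * a (OS4.gen .betaStar) * hw + a (OS4.gen .betaStar) * hc
    · linear_combination c * (1 + a (OS4.gen .x)) * hw + a (OS4.gen .x) * hc
  refine Function.Injective.of_comp (f := r) ?_
  rw [← AlgHom.coe_comp, hr]
  exact ha

/-! ### Compatibility with the torus, and the conclusion -/

theorem baseInclusion_colinear (b : OS4) :
    leftS7.coact (baseInclusion b) =
      baseInclusion.toLinearMap.lTensor OTorus (leftS4.coact b) := by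
  have h : coactTorusS7.comp baseInclusion =
      (Algebra.TensorProduct.map (AlgHom.id ℂ OTorus) baseInclusion).comp coactTorusS4 := by
    refine OS4.algHom_ext fun i => ?_
    have hz : ∀ i, coactTorusS7 (z i) = tpow (weight i) ⊗ₜ z i := leftS7_z
    have hzs : ∀ i, coactTorusS7 (zs i) = tpow (-weight i) ⊗ₜ zs i := leftS7_zs
    have h2 : ∀ f : OS7 →ₐ[ℂ] OTorus ⊗[ℂ] OS7, f 2 = 1 ⊗ₜ 2 := by
      intro f
      rw [map_ofNat, ← map_ofNat (Algebra.TensorProduct.includeRight :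
        OS7 →ₐ[ℂ] OTorus ⊗[ℂ] OS7) 2]
      rfl
    rw [AlgHom.comp_apply, AlgHom.comp_apply, baseInclusion_gen]
    simp only [coactTorusS4, OS4.lift_gen, Algebra.TensorProduct.map_tmul, AlgHom.id_apply,
      baseInclusion_gen]
    cases i <;>
      simp only [baseGen, weightS4, map_mul, map_add, map_sub, hz, hzs, h2,
        Algebra.TensorProduct.tmul_mul_tmul, ← tpow_add, one_mul, TensorProduct.tmul_add,
        TensorProduct.tmul_sub, mul_add, mul_sub] <;>
      simp [weight, sub_eq_add_neg, add_comm]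
  exact congrArg (fun f => f b) h

end InstantonBundle

end

theorem mainTheorem6 (θ : ℝ) :
    (InstantonBundle.rightS7Theta θ).IsPrincipal ∧
    ∃ φ : InstantonBundle.OS4Theta θ →ₐ[ℂ] InstantonBundle.OS7Theta θ,
      (∀ b : InstantonBundle.OS4,
        φ (HopfGalois.Twisted.of InstantonBundle.leftS4 (InstantonBundle.sigma θ) b) =
          HopfGalois.Twisted.of InstantonBundle.leftS7 (InstantonBundle.sigma θ)
            (InstantonBundle.baseInclusion b)) ∧
      Function.Injective φ ∧
      φ.range = (InstantonBundle.rightS7Theta θ).coinvariants := by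
  -- The underlying linear map of the twisted morphism is ι itself, so injectivity and range are
  -- those of the undeformed inclusion.
  refine ⟨InstantonBundle.isPrincipal_rightS7Theta θ,
    HopfGalois.Twisted.map InstantonBundle.baseInclusion InstantonBundle.baseInclusion_colinear
      (InstantonBundle.sigma θ), fun _ => rfl, InstantonBundle.baseInclusion_injective,
    SetLike.ext fun a => ?_⟩
  have h := InstantonBundle.range_baseInclusion
  refine Iff.trans ?_ (HopfGalois.of_mem_coinvariants_twist InstantonBundle.rightS7
    InstantonBundle.coactionsCommute_S7 (InstantonBundle.sigma θ)
    ((HopfGalois.Twisted.of InstantonBundle.leftS7 (InstantonBundle.sigma θ)).symm a)).symm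
  rw [← h]
  exact Iff.rfl
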